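/- **Setting.** Let $N,q\in\mathbb Z_+$, $\kappa>0$, $A_k\in\mathbb R^{n\times n}$, $B_k\in\mathbb R^{n\times m}$, $R_k\succ0$ for $0\le k<N$, $Q_k\succeq 0$ and reference states $x'_k\in\mathbb R^n$ for $0\le k\le N$, and consider $x_{k+1}=A_kx_k+B_ku_k$ with cost $$J=(x_N-x_N')^{\mathrm T}Q_N(x_N-x'_N)+\sum_{k<N}\big(u_k^{\mathrm T}R_ku_k+(x_k-x_k')^{\mathrm T}Q_k(x_k-x'_k)\big).$$ The initial state has the Gaussian mixture law $\sum_{i<r}p_i^0\,\mathcal N(\mu_i^0,\Sigma_i^0)$ and the desired law is $\sum_{j<t}p_j^d\,\mathcal N(\mu_j^d,\Sigma_j^d)$, with $\mathbf p_0\in\Delta_r$, $\mathbf p_d\in\Delta_t$ (probability simplices) and all $\Sigma_i^0,\Sigma_j^d\succ0$. Put $\Phi_{k,l}=A_{k-1}\cdots A_l$ ($\Phi_{l,l}=I$), let $\mathbf{B_N}=[\Phi_{N,1}B_0,\dots,\Phi_{N,N}B_{N-1}]$, and assume that $\mathcal G=\mathbf{B_N}\mathbf{B_N}^{\mathrm T}$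 is nonsingular. Let $\mathbf R=\mathrm{bdiag}(R_0,\dots,R_{N-1})$, $\mathbf Q=\mathrm{bdiag}(Q_0,\dots,Q_N)$, $\mathbf X'=[x_0';\dots;x_N']$, $\mathbf\Gamma=[\Phi_{0,0};\dots;\Phi_{N,0}]$, let $\mathbf{H_u}$ have blocks $\Phi_{k,l+1}B_l$ for $l<k$ and $0$ otherwise ($0\le k\le N$, $0\le l<N$), and let $M=\mathbf R+\mathbf{H_u}^{\mathrm T}\mathbf Q\mathbf{H_u}$. *Steering subproblems.* $J^\star_{\rm mean}(\mu_0,\mu_1)$ is the minimum of $J_{\rm mean}(\bar U;\mu_0)=\bar U^{\mathrm T}\mathbf R\bar U+Z^{\mathrm T}\mathbf QZ$, $Z=\mathbf\Gamma\mu_0+\mathbf{H_u}\bar U-\mathbf X'$, over $\{\bar U:\mu_1=\Phi_{N,0}\mu_0+\mathbf{B_N}\bar U\}$. It is attained at $$\bar U^\star=\tfrac12M^{-1}(\mathbf{B_N}^{\mathrm T}\Lambda-2\mathbf{H_u}^{\mathrm T}\mathbf QY_0),\qquad \Lambda=2(\mathbf{B_N}M^{-1}\mathbf{B_N}^{\mathrm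 T})^{-1}\big(\mathbf{B_N}M^{-1}\mathbf{H_u}^{\mathrm T}\mathbf QY_0+\mu_1-\Phi_{N,0}\mu_0\big),$$ with $Y_0=\mathbf\Gamma\mu_0-\mathbf X'$. $J^\star_{\rm cov}(\Sigma_0,\Sigma_1)$ is the minimum of $\mathrm{tr}(\mathbf R\mathbf L\Sigma_0\mathbf L^{\mathrm T})+\mathrm{tr}(\mathbf Q(\mathbf\Gamma+\mathbf{H_u}\mathbf L)\Sigma_0(\mathbf\Gamma+\mathbf{H_u}\mathbf L)^{\mathrm T})$ over $\{\mathbf L:\Sigma_1=(\Phi_{N,0}+\mathbf{B_N}\mathbf L)\Sigma_0(\Phi_{N,0}+\mathbf{B_N}\mathbf L)^{\mathrm T}\}$. *Policies.* A policy $\pi\in\Pi_r$ consists of weights $\lambda_{ij}\ge0$ with $\sum_{j<q}\lambda_{ij}=1$, gains $\mathbf L_{ij}\in\mathbb R^{mN\times n}$ and vectors $\bar U_{ij}\in\mathbb R^{mN}$ ($i<r$, $j<q$). Given $x_0$ it applies the control sequence $\mathbf L_{ij}(x_0-\mu_i^0)+\bar U_{ij}$ with probability $\lambda_{ij}\ell_i(x_0)$,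 where $\ell_i(x_0)$ is the posterior weight of the $i$-th initial component given $x_0$. It is required that for each $j$ all branches $(i,j)$ lead to the same terminal mean and covariance, $\mu_j^N=\Phi_{N,0}\mu_i^0+\mathbf{B_N}\bar U_{ij}$ and $\Sigma_j^N=(\Phi_{N,0}+\mathbf{B_N}\mathbf L_{ij})\Sigma_i^0(\Phi_{N,0}+\mathbf{B_N}\mathbf L_{ij})^{\mathrm T}$ for all $i$. With $p_j^N=\sum_ip_i^0\lambda_{ij}$, the **soft-constrained problem over $\Pi_r$** is to minimise $\mathbb E[J]+\kappa W_{\rm GMM}^2$. Here $W^2_{\rm GMM}$ is the minimum of $\sum_{j,l}\beta_{jl}W_{\mathcal N}^2(\mu_j^N,\Sigma_j^N,\mu_l^d,\Sigma_l^d)$ over the nonnegative $\beta\in\mathbb R^{q\times t}$ with row sums $\mathbf p_N$ and column sums $\mathbf p_d$, and $$W_{\mathcal N}^2(\mu,\Sigma,\mu',\Sigma')=\|\mu-\mu'\|^2+\mathrm{tr}(\Sigma+\Sigma')-2\,\mathrm{tr}\big((\Sigma'^{1/2}\Sigma\Sigma'^{1/2})^{1/2}\big).$$ *Bilinear program.*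 Let $\mathbf D\in\mathbb R^{mN\times(mN-n)}$ be any full-rank matrix with $\mathbf{B_N}\mathbf D=0$. Put $\Theta_1=I-\mathbf D(\mathbf D^{\mathrm T}M\mathbf D)^{-1}\mathbf D^{\mathrm T}M$, $\Theta_2=\mathbf D(\mathbf D^{\mathrm T}M\mathbf D)^{-1}\mathbf D^{\mathrm T}\mathbf{H_u}^{\mathrm T}\mathbf Q\mathbf\Gamma$, $\Theta_3=\mathbf{B_N}^{\mathrm T}\mathcal G^{-1}\Phi_{N,0}$, $\Theta_4=\Theta_1\Theta_3+\Theta_2$, $\Theta_5=\mathbf\Gamma-\mathbf{H_u}\Theta_4$, $\Theta_6=\mathcal G^{-1}\mathbf{B_N}\Theta_1^{\mathrm T}M\Theta_1\mathbf{B_N}^{\mathrm T}\mathcal G^{-\mathrm T}$, $\Theta_7=\Theta_4^{\mathrm T}\mathbf R\Theta_4+\Theta_5^{\mathrm T}\mathbf Q\Theta_5$ and $\Theta_8=(\Theta_5^{\mathrm T}\mathbf Q\mathbf{H_u}-\Theta_4^{\mathrm T}\mathbf R)\Theta_1\mathbf{B_N}^{\mathrm T}\mathcal G^{-1}$. Over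 $(\tilde\lambda,\mathbf C,\beta,\mathbf T,\mathbf p_N,L_{ij},Y_{ij},\mu_j^N,\Sigma_j^N)$ with $\mathbf p_N\in\Delta_q$, consider $$\begin{aligned}\min\ &\mathrm{tr}(\mathbf C^{\mathrm T}\tilde\lambda)+\kappa\,\mathrm{tr}(\mathbf T^{\mathrm T}\beta)\\ \text{s.t. }&\tilde\lambda\mathbf 1=\mathbf p_0,\ \tilde\lambda^{\mathrm T}\mathbf 1=\mathbf p_N,\ \tilde\lambda\ge0,\qquad \beta\mathbf 1=\mathbf p_N,\ \beta^{\mathrm T}\mathbf 1=\mathbf p_d,\ \beta\ge0,\\ &\mathbf C_{ij}\ge J^\star_{\rm mean}(\mu_i^0,\mu_j^N)+\mathrm{tr}(\Theta_6\Sigma_j^N)+\mathrm{tr}(\Theta_7\Sigma_i^0)+\mathrm{tr}(L_{ij}+L_{ij}^{\mathrm T}),\quad\begin{bmatrix}\Theta_8\Sigma_j^N\Theta_8^{\mathrm T}&L_{ij}\\L_{ij}^{\mathrm T}&\Sigma_i^0\end{bmatrix}\succeq0\quad(i<r,\ j<q),\\ &\mathbf T_{ij}\ge\|\mu_j^d-\mu_i^N\|^2+\mathrm{tr}\,\Sigma_i^N+\mathrm{tr}\,\Sigma_j^d+\mathrm{tr}(Y_{ij}+Y_{ij}^{\mathrm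 T}),\quad\begin{bmatrix}\Sigma_i^N&Y_{ij}\\Y_{ij}^{\mathrm T}&\Sigma_j^d\end{bmatrix}\succeq0\quad(i<q,\ j<t).\end{aligned}$$ In both problems the covariances $\Sigma_j^N$ range over the same set, which may be either all positive definite or all positive semidefinite $n\times n$ matrices. **Theorem.** For each of these two choices: 1. Every feasible policy has finite expected cost, and its terminal law is $\sum_jp_j^N\mathcal N(\mu_j^N,\Sigma_j^N)$. 2. The soft-constrained problem over $\Pi_r$ and the bilinear program are feasible and have the same finite infimum. 3. From a feasible point of the program, form a policy with $\lambda_{ij}=\tilde\lambda_{ij}/p_i^0$ (any probability vector as row $i$ if $p_i^0=0$), $\bar U_{ij}$ any solution of the mean steering problem from $\mu_i^0$ to $\mu_j^N$ (for example $\bar U^\star$) and $\mathbf L_{ij}$ any solution of the covariance steering problem from $\Sigma_i^0$ to $\Sigma_j^N$ (solutions exist). This policy is feasible with terminal parameters $(\mathbf p_N,\mu^N,\Sigma^N)$ and costs no more than the point. If the point is optimal, then the policy is optimal and the two costs agree. 4. Conversely, every optimal policy comes from an optimal point of the program with $\tilde\lambda_{ij}=p_i^0\lambda_{ij}$, the same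 $\mathbf p_N,\mu^N,\Sigma^N$ and the same cost. 5. The inequality constraints are tight at optimality. At every optimal point, the constraint on $\mathbf C_{ij}$ is an equality and $\mathbf C_{ij}=J^\star_{\rm mean}(\mu_i^0,\mu_j^N)+J^\star_{\rm cov}(\Sigma_i^0,\Sigma_j^N)$ whenever $\tilde\lambda_{ij}>0$. Likewise, the constraint on $\mathbf T_{ij}$ is an equality and $\mathbf T_{ij}=W_{\mathcal N}^2(\mu_i^N,\Sigma_i^N,\mu_j^d,\Sigma_j^d)$ whenever $\beta_{ij}>0$. Moreover, there is an optimal point with the same $\tilde\lambda,\beta,\mathbf p_N,\mu^N,\Sigma^N$ at which all these equalities hold for all index pairs. -/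

import Mathlib

open Matrix MeasureTheory ProbabilityTheory
open scoped MatrixOrder

noncomputable section

/-! ### Gaussian mixtures and the Wasserstein-type distance between them -/

/-- Density at `x` of the nondegenerate Gaussian with mean `μ` and covariance `S`. -/
def gaussDensity {n : ℕ} (μ : Fin n → ℝ) (S : Matrix (Fin n) (Fin n) ℝ) (x : Fin n → ℝ) : ℝ :=
  (Real.sqrt ((2 * Real.pi) ^ n * S.det))⁻¹ *
    Real.exp (-((x - μ) ⬝ᵥ (S⁻¹ *ᵥ (x - μ))) / 2)

/-- Parameters of a Gaussian mixture on `ℝⁿ` with `q` components: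
weights, means and covariance matrices. -/
structure GMMParams (n q : ℕ) where
  weight : Fin q → ℝ
  mean : Fin q → Fin n → ℝ
  cov : Fin q → Matrix (Fin n) (Fin n) ℝ

/-- The law on `ℝⁿ` described by the parameters of a Gaussian mixture. -/
def GMMParams.law {n q : ℕ} (g : GMMParams n q) : Measure (EuclideanSpace ℝ (Fin n)) :=
  ∑ i, ENNReal.ofReal (g.weight i) • multivariateGaussian (WithLp.toLp 2 (g.mean i)) (g.cov i)

/-- Closed form of the squared 2-Wasserstein distance between two Gaussians:
`‖μx - μy‖² + tr (Sx + Sy) - 2 tr ((Sy^{1/2} Sx Sy^{1/2})^{1/2})`. -/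
def gaussW2Sq {n : ℕ} (μx : Fin n → ℝ) (Sx : Matrix (Fin n) (Fin n) ℝ)
    (μy : Fin n → ℝ) (Sy : Matrix (Fin n) (Fin n) ℝ) : ℝ :=
  (μx - μy) ⬝ᵥ (μx - μy) + (Sx + Sy).trace
    - 2 * (CFC.sqrt (CFC.sqrt Sy * Sx * CFC.sqrt Sy)).trace

/-- Couplings of two weight vectors: nonnegative matrices with prescribed row and column sums. -/
def couplings {a b : ℕ} (p : Fin a → ℝ) (p' : Fin b → ℝ) : Set (Matrix (Fin a) (Fin b) ℝ) :=
  {X | X *ᵥ 1 = p ∧ Xᵀ *ᵥ 1 = p' ∧ ∀ i j, 0 ≤ X i j}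

/-- The GMM-Wasserstein distance: square root of the optimal value of the discrete transport
problem between the mixture components with ground cost `gaussW2Sq`. -/
def gmmW {n a b : ℕ} (g : GMMParams n a) (g' : GMMParams n b) : ℝ :=
  Real.sqrt (sInf ((fun X : Matrix (Fin a) (Fin b) ℝ =>
    ∑ i, ∑ j, gaussW2Sq (g.mean i) (g.cov i) (g'.mean j) (g'.cov j) * X i j) ''
      couplings g.weight g'.weight))

/-! ### The steering problem -/

/-- Data of the soft-constrained steering problem with state dimension `n`, input dimension `m`,
horizon `N`, `r` initial and `t` desired mixture components. Only the values `A k, B k, R k` with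
`k < N` and `Q k, xref k` with `k ≤ N` matter. -/
structure SteeringData (n m N r t : ℕ) where
  A : ℕ → Matrix (Fin n) (Fin n) ℝ
  B : ℕ → Matrix (Fin n) (Fin m) ℝ
  R : ℕ → Matrix (Fin m) (Fin m) ℝ
  Q : ℕ → Matrix (Fin n) (Fin n) ℝ
  xref : ℕ → Fin n → ℝ
  κ : ℝ
  init : GMMParams n r
  des : GMMParams n t

namespace SteeringData

variable {n m N r t : ℕ} (P : SteeringData n m N r t)

/-- Transition matrix `Φ k k₀ = A_{k-1} ⋯ A_{k₀}` for `k₀ ≤ k`, with `Φ k₀ k₀ = I`. -/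
def Φ : ℕ → ℕ → Matrix (Fin n) (Fin n) ℝ
  | 0, _ => 1
  | k + 1, k₀ => if k₀ ≤ k then P.A k * Φ k k₀ else 1

/-- Controllability Gramian over the horizon. -/
def gramian : Matrix (Fin n) (Fin n) ℝ :=
  ∑ k ∈ Finset.range N, P.Φ N (k + 1) * P.B k * (P.B k)ᵀ * (P.Φ N (k + 1))ᵀ

/-- Standing assumptions on the data. -/
structure Standing : Prop where
  horizon_pos : 0 < N
  kappa_pos : 0 < P.κ
  R_posDef : ∀ k < N, (P.R k).PosDef
  Q_posSemidef : ∀ k ≤ N, (P.Q k).PosSemidef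
  init_weight : P.init.weight ∈ stdSimplex ℝ (Fin r)
  init_cov : ∀ i, (P.init.cov i).PosDef
  des_weight : P.des.weight ∈ stdSimplex ℝ (Fin t)
  des_cov : ∀ j, (P.des.cov j).PosDef
  controllable : IsUnit P.gramian.det

/-! Stacked vectors: a control sequence is a vector indexed by `Fin m × Fin N` (coordinate, time),
a state sequence is a vector indexed by `Fin n × Fin (N + 1)`. -/

/-- The control at time `k` of a stacked control sequence. -/
def ctrl (U : Fin m × Fin N → ℝ) (k : ℕ) : Fin m → ℝ :=
  fun a => if h : k < N then U (a, ⟨k, h⟩) else 0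

/-- State trajectory `x_{k+1} = A_k x_k + B_k u_k`. -/
def traj (x₀ : Fin n → ℝ) (U : Fin m × Fin N → ℝ) : ℕ → Fin n → ℝ
  | 0 => x₀
  | k + 1 => P.A k *ᵥ traj x₀ U k + P.B k *ᵥ ctrl U k

/-- Quadratic cost of the trajectory generated by an initial state and a control sequence. -/
def cost (x₀ : Fin n → ℝ) (U : Fin m × Fin N → ℝ) : ℝ :=
  (P.traj x₀ U N - P.xref N) ⬝ᵥ (P.Q N *ᵥ (P.traj x₀ U N - P.xref N)) +
    ∑ k ∈ Finset.range N, (ctrl U k ⬝ᵥ (P.R k *ᵥ ctrl U k) +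
      (P.traj x₀ U k - P.xref k) ⬝ᵥ (P.Q k *ᵥ (P.traj x₀ U k - P.xref k)))

/-! ### Mixture policies -/

end SteeringData

/-- Parameters of a randomized policy: for every pair `(i, j)` a mixing weight, a stacked
feedback gain and a stacked feed-forward control. -/
structure MixPolicy (n m N r q : ℕ) where
  lam : Matrix (Fin r) (Fin q) ℝ
  gain : Fin r → Fin q → Matrix (Fin m × Fin N) (Fin n) ℝ
  ff : Fin r → Fin q → Fin m × Fin N → ℝ

/-- The class `Π_r`: the mixing weights of every initial component form a probability vector. -/
def MixPolicy.IsPolicy {n m N r q : ℕ} (π : MixPolicy n m N r q) : Prop :=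
  ∀ i, π.lam i ∈ stdSimplex ℝ (Fin q)

namespace SteeringData

variable {n m N r t : ℕ} (P : SteeringData n m N r t)

/-- Posterior weight `ℓ_i(x)` of the `i`-th initial component given the initial state `x`. -/
def posterior (i : Fin r) (x : Fin n → ℝ) : ℝ :=
  P.init.weight i * gaussDensity (P.init.mean i) (P.init.cov i) x /
    ∑ i', P.init.weight i' * gaussDensity (P.init.mean i') (P.init.cov i') x

/-- Control sequence applied in branch `(i, j)`: `L_{ij} (x₀ - μ_i) + ū_{ij}`. -/
def branch {q : ℕ} (π : MixPolicy n m N r q) (i : Fin r) (j : Fin q) (x : Fin n → ℝ) :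
    Fin m × Fin N → ℝ :=
  π.gain i j *ᵥ (x - P.init.mean i) + π.ff i j

theorem measurable_posterior (i : Fin r) :
    Measurable fun x : EuclideanSpace ℝ (Fin n) => P.posterior i (WithLp.ofLp x) := by
  have h : ∀ (μ : Fin n → ℝ) (S : Matrix (Fin n) (Fin n) ℝ),
      Measurable fun x : EuclideanSpace ℝ (Fin n) => gaussDensity μ S (WithLp.ofLp x) := by
    intro μ S
    apply Continuous.measurable
    unfold gaussDensity
    simp only [dotProduct, mulVec]
    fun_prop
  unfold posterior
  exact ((h _ _).const_mul _).div
    (Finset.measurable_sum _ fun i' _ => (h _ _).const_mul _)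

theorem measurable_branch {q : ℕ} (π : MixPolicy n m N r q) (i : Fin r) (j : Fin q) :
    Measurable fun x : EuclideanSpace ℝ (Fin n) => P.branch π i j (WithLp.ofLp x) := by
  apply Continuous.measurable
  unfold branch
  refine continuous_pi fun a => ?_
  simp only [Pi.add_apply, dotProduct, mulVec]
  fun_prop

/-- The randomized policy as a kernel: given the initial state `x`, the pair `(i, j)` is drawn with
probability `γ_{ij}(x) = λ_{ij} ℓ_i(x)` and the control sequence of branch `(i, j)` is applied. -/
def ctrlKernel {q : ℕ} (π : MixPolicy n m N r q) :
    Kernel (EuclideanSpace ℝ (Fin n)) (Fin m × Fin N → ℝ) where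
  toFun x := ∑ i, ∑ j, ENNReal.ofReal (π.lam i j * P.posterior i (WithLp.ofLp x)) •
    Measure.dirac (P.branch π i j (WithLp.ofLp x))
  measurable' := by
    refine Finset.measurable_sum _ fun i _ => Finset.measurable_sum _ fun j _ => ?_
    refine Measure.measurable_of_measurable_coe _ fun s hs => ?_
    simp only [Measure.smul_apply, smul_eq_mul]
    exact ((P.measurable_posterior i).const_mul _).ennreal_ofReal.mul
      ((Measure.measurable_coe hs).comp (Measure.measurable_dirac.comp (P.measurable_branch π i j)))

/-- Joint law of the initial state and the control sequence under a policy. -/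
def closedLoop {q : ℕ} (π : MixPolicy n m N r q) :
    Measure (EuclideanSpace ℝ (Fin n) × (Fin m × Fin N → ℝ)) :=
  P.init.law ⊗ₘ P.ctrlKernel π

/-- Law of the terminal state under a policy. -/
def terminalLaw {q : ℕ} (π : MixPolicy n m N r q) : Measure (EuclideanSpace ℝ (Fin n)) :=
  (P.closedLoop π).map fun z => WithLp.toLp 2 (P.traj (WithLp.ofLp z.1) z.2 N)

/-- Expected quadratic cost under a policy. -/
def expCost {q : ℕ} (π : MixPolicy n m N r q) : ℝ :=
  ∫ z, P.cost (WithLp.ofLp z.1) z.2 ∂(P.closedLoop π)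

/-! ### Stacked matrices, mean steering and covariance steering -/

/-- Block-diagonal control weight. -/
def Rb : Matrix (Fin m × Fin N) (Fin m × Fin N) ℝ := blockDiagonal fun k : Fin N => P.R k

/-- Block-diagonal state weight. -/
def Qb : Matrix (Fin n × Fin (N + 1)) (Fin n × Fin (N + 1)) ℝ :=
  blockDiagonal fun k : Fin (N + 1) => P.Q k

/-- Stacked reference trajectory. -/
def Xref : Fin n × Fin (N + 1) → ℝ := fun z => P.xref z.2 z.1

/-- `Γ = [Φ_{0,0}; …; Φ_{N,0}]`. -/
def Γ : Matrix (Fin n × Fin (N + 1)) (Fin n) ℝ := Matrix.of fun z b => P.Φ z.2 0 z.1 b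

/-- `H_u`, with block `(k, l)` equal to `Φ_{k,l+1} B_l` if `l < k` and `0` otherwise. -/
def Hu : Matrix (Fin n × Fin (N + 1)) (Fin m × Fin N) ℝ := Matrix.of fun z w =>
  if (w.2 : ℕ) < (z.2 : ℕ) then (P.Φ z.2 (w.2 + 1) * P.B w.2) z.1 w.1 else 0

/-- `B_N = [Φ_{N,1} B_0, …, Φ_{N,N} B_{N-1}]`. -/
def BN : Matrix (Fin n) (Fin m × Fin N) ℝ := Matrix.of fun a w =>
  (P.Φ N (w.2 + 1) * P.B w.2) a w.1

/-- `M = R + H_uᵀ Q H_u`. -/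
def M : Matrix (Fin m × Fin N) (Fin m × Fin N) ℝ := P.Rb + P.Huᵀ * P.Qb * P.Hu

/-- Objective of the mean steering problem. -/
def Jmean (μ₀ : Fin n → ℝ) (U : Fin m × Fin N → ℝ) : ℝ :=
  U ⬝ᵥ (P.Rb *ᵥ U) +
    (P.Γ *ᵥ μ₀ + P.Hu *ᵥ U - P.Xref) ⬝ᵥ (P.Qb *ᵥ (P.Γ *ᵥ μ₀ + P.Hu *ᵥ U - P.Xref))

/-- Feed-forward controls steering the mean from `μ₀` to `μ₁`. -/
def meanFeasible (μ₀ μ₁ : Fin n → ℝ) : Set (Fin m × Fin N → ℝ) :=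
  {U | μ₁ = P.Φ N 0 *ᵥ μ₀ + P.BN *ᵥ U}

/-- `U` solves the mean steering problem. -/
def SolvesMean (μ₀ μ₁ : Fin n → ℝ) (U : Fin m × Fin N → ℝ) : Prop :=
  U ∈ P.meanFeasible μ₀ μ₁ ∧ IsMinOn (P.Jmean μ₀) (P.meanFeasible μ₀ μ₁) U

/-- Multiplier of the mean steering problem in closed form. -/
def multStar (μ₀ μ₁ : Fin n → ℝ) : Fin n → ℝ :=
  (2 : ℝ) • ((P.BN * P.M⁻¹ * P.BNᵀ)⁻¹ *ᵥ
    ((P.BN * P.M⁻¹ * P.Huᵀ * P.Qb) *ᵥ (P.Γ *ᵥ μ₀ - P.Xref) + (μ₁ - P.Φ N 0 *ᵥ μ₀)))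

/-- Optimal feed-forward control of the mean steering problem in closed form. -/
def Ustar (μ₀ μ₁ : Fin n → ℝ) : Fin m × Fin N → ℝ :=
  (1 / 2 : ℝ) • (P.M⁻¹ *ᵥ
    (P.BNᵀ *ᵥ P.multStar μ₀ μ₁ - (2 : ℝ) • ((P.Huᵀ * P.Qb) *ᵥ (P.Γ *ᵥ μ₀ - P.Xref))))

/-- Optimal mean steering cost, an explicit quadratic function of `(μ₀, μ₁)`. -/
def JmeanStar (μ₀ μ₁ : Fin n → ℝ) : ℝ := P.Jmean μ₀ (P.Ustar μ₀ μ₁)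

/-- Objective of the covariance steering problem. -/
def Jcov (S₀ : Matrix (Fin n) (Fin n) ℝ) (L : Matrix (Fin m × Fin N) (Fin n) ℝ) : ℝ :=
  (P.Rb * L * S₀ * Lᵀ).trace + (P.Qb * (P.Γ + P.Hu * L) * S₀ * (P.Γ + P.Hu * L)ᵀ).trace

/-- Feedback gains steering the covariance from `S₀` to `S₁`. -/
def covFeasible (S₀ S₁ : Matrix (Fin n) (Fin n) ℝ) : Set (Matrix (Fin m × Fin N) (Fin n) ℝ) :=
  {L | S₁ = (P.Φ N 0 + P.BN * L) * S₀ * (P.Φ N 0 + P.BN * L)ᵀ}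

/-- `L` solves the covariance steering problem. -/
def SolvesCov (S₀ S₁ : Matrix (Fin n) (Fin n) ℝ) (L : Matrix (Fin m × Fin N) (Fin n) ℝ) : Prop :=
  L ∈ P.covFeasible S₀ S₁ ∧ IsMinOn (P.Jcov S₀) (P.covFeasible S₀ S₁) L

/-- Optimal covariance steering cost. -/
def JcovStar (S₀ S₁ : Matrix (Fin n) (Fin n) ℝ) : ℝ := sInf (P.Jcov S₀ '' P.covFeasible S₀ S₁)

/-! ### The steering problem over mixture policies -/

/-- `g` collects the parameters of the terminal mixture produced by the policy `π`: its weights are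
`∑ i, p_i λ_ij`, and for every `j` all branches `(i, j)` lead to the same Gaussian `j`. -/
structure IsTerminalGMM {q : ℕ} (π : MixPolicy n m N r q) (g : GMMParams n q) : Prop where
  weight_eq : ∀ j, g.weight j = ∑ i, P.init.weight i * π.lam i j
  mean_eq : ∀ i j, g.mean j = P.Φ N 0 *ᵥ P.init.mean i + P.BN *ᵥ π.ff i j
  cov_eq : ∀ i j, g.cov j =
    (P.Φ N 0 + P.BN * π.gain i j) * P.init.cov i * (P.Φ N 0 + P.BN * π.gain i j)ᵀ

/-- Feasible points of the steering problem over policies with `q` terminal components, the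
covariance matrices of which range over the set `𝒮`: policies together with the terminal mixture
that they produce. -/
def policyFeasible (q : ℕ) (𝒮 : Set (Matrix (Fin n) (Fin n) ℝ)) :
    Set (MixPolicy n m N r q × GMMParams n q) :=
  {z | z.1.IsPolicy ∧ P.IsTerminalGMM z.1 z.2 ∧ ∀ j, z.2.cov j ∈ 𝒮}

/-- Objective: expected quadratic cost plus `κ` times the squared GMM-Wasserstein distance. -/
def policyCost {q : ℕ} (z : MixPolicy n m N r q × GMMParams n q) : ℝ :=
  P.expCost z.1 + P.κ * gmmW z.2 P.des ^ 2

/-! ### The bilinear program -/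

section Theta

variable {d : ℕ} (D : Matrix (Fin m × Fin N) (Fin d) ℝ)

def Θ₁ : Matrix (Fin m × Fin N) (Fin m × Fin N) ℝ := 1 - D * (Dᵀ * P.M * D)⁻¹ * Dᵀ * P.M

def Θ₂ : Matrix (Fin m × Fin N) (Fin n) ℝ :=
  D * (Dᵀ * P.M * D)⁻¹ * Dᵀ * P.Huᵀ * P.Qb * P.Γ

def Θ₃ : Matrix (Fin m × Fin N) (Fin n) ℝ := P.BNᵀ * P.gramian⁻¹ * P.Φ N 0

def Θ₄ : Matrix (Fin m × Fin N) (Fin n) ℝ := P.Θ₁ D * P.Θ₃ + P.Θ₂ D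

def Θ₅ : Matrix (Fin n × Fin (N + 1)) (Fin n) ℝ := P.Γ - P.Hu * P.Θ₄ D

def Θ₆ : Matrix (Fin n) (Fin n) ℝ :=
  P.gramian⁻¹ * P.BN * (P.Θ₁ D)ᵀ * P.M * P.Θ₁ D * P.BNᵀ * (P.gramian⁻¹)ᵀ

def Θ₇ : Matrix (Fin n) (Fin n) ℝ :=
  (P.Θ₄ D)ᵀ * P.Rb * P.Θ₄ D + (P.Θ₅ D)ᵀ * P.Qb * P.Θ₅ D

def Θ₈ : Matrix (Fin n) (Fin n) ℝ :=
  ((P.Θ₅ D)ᵀ * P.Qb * P.Hu - (P.Θ₄ D)ᵀ * P.Rb) * P.Θ₁ D * P.BNᵀ * P.gramian⁻¹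

end Theta

end SteeringData

/-- Decision variables of the bilinear program. -/
structure BilinVars (n r q t : ℕ) where
  lamT : Matrix (Fin r) (Fin q) ℝ
  C : Matrix (Fin r) (Fin q) ℝ
  β : Matrix (Fin q) (Fin t) ℝ
  T : Matrix (Fin q) (Fin t) ℝ
  pN : Fin q → ℝ
  L : Fin r → Fin q → Matrix (Fin n) (Fin n) ℝ
  Y : Fin q → Fin t → Matrix (Fin n) (Fin n) ℝ
  μN : Fin q → Fin n → ℝ
  SN : Fin q → Matrix (Fin n) (Fin n) ℝ

/-- The terminal mixture encoded in the decision variables. -/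
def BilinVars.gmm {n r q t : ℕ} (s : BilinVars n r q t) : GMMParams n q := ⟨s.pN, s.μN, s.SN⟩

namespace SteeringData

variable {n m N r t q d : ℕ} (P : SteeringData n m N r t)
  (D : Matrix (Fin m × Fin N) (Fin d) ℝ)

/-- Lower bound imposed on `C i j`. -/
def boundC (s : BilinVars n r q t) (i : Fin r) (j : Fin q) : ℝ :=
  P.JmeanStar (P.init.mean i) (s.μN j) + (P.Θ₆ D * s.SN j).trace +
    (P.Θ₇ D * P.init.cov i).trace + (s.L i j + (s.L i j)ᵀ).trace

/-- Lower bound imposed on `T i j`. -/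
def boundT (s : BilinVars n r q t) (i : Fin q) (j : Fin t) : ℝ :=
  (P.des.mean j - s.μN i) ⬝ᵥ (P.des.mean j - s.μN i) + (s.SN i).trace +
    (P.des.cov j).trace + (s.Y i j + (s.Y i j)ᵀ).trace

/-- Constraints of the bilinear program. -/
structure IsBilinFeasible (𝒮 : Set (Matrix (Fin n) (Fin n) ℝ)) (s : BilinVars n r q t) :
    Prop where
  weights : s.pN ∈ stdSimplex ℝ (Fin q)
  cov_mem : ∀ j, s.SN j ∈ 𝒮
  lam_coupling : s.lamT ∈ couplings P.init.weight s.pN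
  beta_coupling : s.β ∈ couplings s.pN P.des.weight
  C_bound : ∀ i j, P.boundC D s i j ≤ s.C i j
  C_lmi : ∀ i j, (fromBlocks (P.Θ₈ D * s.SN j * (P.Θ₈ D)ᵀ) (s.L i j)
    (s.L i j)ᵀ (P.init.cov i)).PosSemidef
  T_bound : ∀ i j, P.boundT s i j ≤ s.T i j
  T_lmi : ∀ i j, (fromBlocks (s.SN i) (s.Y i j) (s.Y i j)ᵀ (P.des.cov j)).PosSemidef

/-- Feasible set of the bilinear program with `q` terminal components. -/
def bilinFeasible (q : ℕ) (𝒮 : Set (Matrix (Fin n) (Fin n) ℝ)) : Set (BilinVars n r q t) :=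
  {s | P.IsBilinFeasible D 𝒮 s}

/-- Objective of the bilinear program. -/
def bilinCost (s : BilinVars n r q t) : ℝ :=
  (s.Cᵀ * s.lamT).trace + P.κ * (s.Tᵀ * s.β).trace

/-- Both families of epigraph constraints hold with equality, and the common values are the optimal
steering costs and the squared Gaussian Wasserstein distances. -/
structure IsTight (s : BilinVars n r q t) : Prop where
  C_eq : ∀ i j, s.C i j = P.boundC D s i j
  C_value : ∀ i j, s.C i j =
    P.JmeanStar (P.init.mean i) (s.μN j) + P.JcovStar (P.init.cov i) (s.SN j)
  T_eq : ∀ i j, s.T i j = P.boundT s i j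
  T_value : ∀ i j, s.T i j = gaussW2Sq (s.μN i) (s.SN i) (P.des.mean j) (P.des.cov j)

/-- The policy extracted from `s` with mixing weights `lamT i j / p_i` (an arbitrary probability
vector in a row with `p_i = 0`) and with optimal mean and covariance steering controls in every
branch. -/
structure IsExtracted (s : BilinVars n r q t) (π : MixPolicy n m N r q) : Prop where
  isPolicy : ∀ i, P.init.weight i = 0 → π.lam i ∈ stdSimplex ℝ (Fin q)
  lam_eq : ∀ i j, P.init.weight i ≠ 0 → π.lam i j = s.lamT i j / P.init.weight i
  ff_opt : ∀ i j, P.SolvesMean (P.init.mean i) (s.μN j) (π.ff i j)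
  gain_opt : ∀ i j, P.SolvesCov (P.init.cov i) (s.SN j) (π.gain i j)

end SteeringData

end

/-! Two reductions carry the theorem. The first is probabilistic. By Bayes' rule, weighting the
initial law by the posterior `ℓ_i` leaves `p_i` times the `i`-th Gaussian
(`law_withDensity_posterior`). The closed loop is therefore a mixture over the branches `(i, j)`
with weights `p_i λ_ij` (`closedLoop_eq`). In each branch the control is affine in a Gaussian
initial state, so the terminal state is Gaussian and the expected cost is `Jmean + Jcov` of that
branch. Once weights and terminal parameters are fixed, the problem splits into independent mean
steering, covariance steering and discrete transport problems.

The second is a matrix computation. For `S` positive definite, the least trace of `L` subject to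
`[P, L; Lᵀ, S] ⪰ 0` is `-tr (S^{1/2} P S^{1/2})^{1/2}`. The bound is `neg_trace_cfcSqrt_le_trace`.
If `P = Θ S₁ Θᵀ`, it is attained at `L = Θ F S`, where `F` satisfies `F S Fᵀ = S₁` and comes from a
polar decomposition (`exists_congruence_trace_eq`). With `Θ = 1` this describes the Gaussian
Wasserstein distance. It also solves covariance steering: among gains with a given closed-loop
transition matrix `F`, the best one costs `tr (Θ₆ F S₀ Fᵀ) + tr (Θ₇ S₀) + 2 tr (Θ₈ F S₀)`
(`Jcov_gainOf`, `Jcov_gainOf_le`). When the terminal covariance is fixed, only the last term varies,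
and minimising it is the matrix problem with `Θ = Θ₈`.

The epigraph variables thus bound the true costs from above, and they enter the objective with
nonnegative weights. A feasible point dominates every policy extracted from it
(`isExtracted_feasible_and_le`), and a policy dominates the tight point built from its parameters
(`exists_bilin_le_policyCost`). Equality of the infima, transfer of minimisers and tightness follow
from these two inequalities and the existence of tight points (`exists_tight_point`). -/

/-! ### Polar decomposition and the trace bound from a linear matrix inequality -/

theorem LinearMap.exists_linearIsometry_apply_eq {E : Type*} [NormedAddCommGroup E]
    [InnerProductSpace ℝ E] [FiniteDimensional ℝ E] (h a : E →ₗ[ℝ] E)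
    (hn : ∀ x, ‖a x‖ = ‖h x‖) : ∃ W : E →ₗᵢ[ℝ] E, ∀ x, W (h x) = a x := by
  obtain ⟨s, hs⟩ := h.rangeRestrict.exists_rightInverse_of_surjective h.range_rangeRestrict
  have hs' : ∀ y : LinearMap.range h, h (s y) = y := fun y =>
    congrArg Subtype.val (LinearMap.congr_fun hs y)
  -- On the range of `h` the isometry is forced to be `h x ↦ a x`. The choice of the section `s` is
  -- immaterial: equality of norms makes the kernel of `h` vanish under `a`. Finite dimension then
  -- allows an extension to all of `E`.
  let g : LinearMap.range h →ₗᵢ[ℝ] E := ⟨a ∘ₗ s, fun y => by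
    rw [LinearMap.comp_apply, hn, hs', Submodule.coe_norm]⟩
  refine ⟨g.extend, fun x => ?_⟩
  have h1 := g.extend_apply ⟨h x, LinearMap.mem_range_self h x⟩
  refine h1.trans ?_
  change a (s _) = a x
  rw [← sub_eq_zero, ← map_sub, ← norm_eq_zero, hn, map_sub, hs', sub_self, norm_zero]

namespace Matrix

variable {n : Type*} [Fintype n] [DecidableEq n]

theorem transpose_cfcSqrt (S : Matrix n n ℝ) : (CFC.sqrt S)ᵀ = CFC.sqrt S :=
  (CFC.sqrt_nonneg S).posSemidef.isHermitian

theorem PosSemidef.cfcSqrt_mul_self {S : Matrix n n ℝ} (hS : S.PosSemidef) :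
    CFC.sqrt S * CFC.sqrt S = S := CFC.sqrt_mul_sqrt_self S hS.nonneg

omit [DecidableEq n] in
theorem PosSemidef.mul_mul_transpose_same {m : Type*} [Fintype m] {S : Matrix n n ℝ}
    (hS : S.PosSemidef) (B : Matrix m n ℝ) : (B * S * Bᵀ).PosSemidef := by
  simpa using hS.mul_mul_conjTranspose_same B

omit [DecidableEq n] in
theorem posSemidef_mul_transpose_self {m : Type*} [Fintype m] (B : Matrix m n ℝ) :
    (B * Bᵀ).PosSemidef := by
  simpa using posSemidef_self_mul_conjTranspose B

theorem PosDef.isUnit_det_cfcSqrt {S : Matrix n n ℝ} (hS : S.PosDef) :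
    IsUnit (CFC.sqrt S).det := by
  have h := hS.det_pos
  rw [← hS.posSemidef.cfcSqrt_mul_self, det_mul] at h
  exact isUnit_iff_ne_zero.2 fun h0 => by simp [h0] at h

/-- Polar decomposition of a real square matrix. -/
theorem exists_orthogonal_mul_eq_cfcSqrt (A : Matrix n n ℝ) :
    ∃ V : Matrix n n ℝ, V * Vᵀ = 1 ∧ A * V = CFC.sqrt (A * Aᵀ) := by
  set H := CFC.sqrt (A * Aᵀ) with hH
  have hHH : H * H = A * Aᵀ := (posSemidef_mul_transpose_self A).cfcSqrt_mul_self
  have hHT : Hᵀ = H := transpose_cfcSqrt _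
  have key : ∀ (B : Matrix n n ℝ) (x : EuclideanSpace ℝ n),
      ‖toEuclideanLin B x‖ ^ 2 = x.ofLp ⬝ᵥ ((Bᵀ * B) *ᵥ x.ofLp) := by
    intro B x
    rw [EuclideanSpace.real_norm_sq_eq, ← mulVec_mulVec, dotProduct_mulVec, vecMul_transpose]
    simp [dotProduct, sq]
  -- `H x` and `Aᵀ x` have the same norm because `H * H = A * Aᵀ`. Working with an isometry instead
  -- of `H⁻¹` covers singular `A`.
  obtain ⟨W, hW⟩ := LinearMap.exists_linearIsometry_apply_eq (toEuclideanLin H)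
    (toEuclideanLin Aᵀ) fun x => by
      rw [← sq_eq_sq₀ (norm_nonneg _) (norm_nonneg _), key, key, transpose_transpose, hHT, hHH]
  obtain ⟨V, hV⟩ := (toEuclideanLin (𝕜 := ℝ) (m := n) (n := n)).surjective W.toLinearMap
  have hV' : ∀ x, toEuclideanLin V x = W x := fun x => by rw [hV]; rfl
  have h1 : Vᵀ * V = 1 := by
    refine ext_of_mulVec_single fun i => ?_
    refine dotProduct_eq _ _ fun w => ?_
    have h2 := W.inner_map_map (WithLp.toLp 2 (Pi.single i 1)) (WithLp.toLp 2 w)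
    rw [← hV', ← hV'] at h2
    simp only [EuclideanSpace.inner_eq_star_dotProduct, toLpLin_toLp] at h2
    rw [← mulVec_mulVec, one_mulVec, dotProduct_comm, dotProduct_mulVec, vecMul_transpose,
      dotProduct_comm _ w]
    simpa using h2
  have h3 : V * H = Aᵀ := by
    refine (toEuclideanLin (𝕜 := ℝ) (m := n) (n := n)).injective (LinearMap.ext fun x => ?_)
    rw [← hW, ← hV']
    simp [toLpLin_apply]
  refine ⟨V, mul_eq_one_comm.1 h1, ?_⟩
  have h4 : A = H * Vᵀ := by rw [← transpose_transpose A, ← h3, transpose_mul, hHT]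
  rw [h4, Matrix.mul_assoc, h1, Matrix.mul_one]

/-- Let `s = S^{1/2}` and let `U` diagonalise `H = (s P s)^{1/2}` with eigenvalues `d_i`. Congruence
by the block diagonal of `Uᵀ s` and `Uᵀ s⁻¹` turns the block matrix into `[diag d², X; Xᵀ, 1]` with
`tr X = tr L`. Positivity forces `X_ii² ≤ d_i²`, and summing `-d_i ≤ X_ii` gives the bound. -/
theorem neg_trace_cfcSqrt_le_trace {P L S : Matrix n n ℝ} (hS : S.PosDef)
    (h : (fromBlocks P L Lᵀ S).PosSemidef) :
    -(CFC.sqrt (CFC.sqrt S * P * CFC.sqrt S)).trace ≤ L.trace := by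
  set s := CFC.sqrt S with hs
  have hsu : IsUnit s.det := hS.isUnit_det_cfcSqrt
  have hsT : sᵀ = s := transpose_cfcSqrt _
  have hss : s * s = S := hS.posSemidef.cfcSqrt_mul_self
  have hP : P.PosSemidef := by
    exact h.submatrix (Sum.inl : n → n ⊕ n)
  have hZ : (s * P * s).PosSemidef := by
    have := hP.mul_mul_transpose_same s
    rwa [hsT] at this
  set H := CFC.sqrt (s * P * s) with hH
  have hHH : H * H = s * P * s := hZ.cfcSqrt_mul_self
  have hHp : H.PosSemidef := (CFC.sqrt_nonneg _).posSemidef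
  set U : Matrix n n ℝ := (hHp.1.eigenvectorUnitary : Matrix n n ℝ) with hU
  have hUU : Uᵀ * U = 1 := by
    have := Unitary.coe_star_mul_self hHp.1.eigenvectorUnitary
    simpa [star_eq_conjTranspose] using this
  have hUU' : U * Uᵀ = 1 := mul_eq_one_comm.1 hUU
  have hD : Uᵀ * H * U = diagonal hHp.1.eigenvalues := by
    have := hHp.1.conjStarAlgAut_star_eigenvectorUnitary
    simpa [Unitary.conjStarAlgAut_apply, star_eq_conjTranspose] using this
  have hB := h.mul_mul_transpose_same (fromBlocks (Uᵀ * s) 0 0 (Uᵀ * s⁻¹))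
  have hsiT : s⁻¹ᵀ = s⁻¹ := by rw [transpose_nonsing_inv, hsT]
  rw [fromBlocks_transpose, fromBlocks_multiply, fromBlocks_multiply] at hB
  simp only [Matrix.mul_zero, Matrix.zero_mul, add_zero, zero_add, transpose_mul,
    transpose_transpose, transpose_zero, hsT, hsiT] at hB
  have h11 : Uᵀ * s * P * (s * U) = diagonal (fun i => hHp.1.eigenvalues i ^ 2) := by
    calc _ = Uᵀ * (s * P * s) * U := by simp only [Matrix.mul_assoc]
      _ = (Uᵀ * H * U) * (Uᵀ * H * U) := by
        rw [← hHH]; simp only [Matrix.mul_assoc]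
        rw [← Matrix.mul_assoc U, hUU', Matrix.one_mul]
      _ = _ := by rw [hD, diagonal_mul_diagonal]; simp [sq]
  have h22 : Uᵀ * s⁻¹ * S * (s⁻¹ * U) = 1 := by
    rw [← hss]; simp only [Matrix.mul_assoc]
    rw [← Matrix.mul_assoc s s⁻¹, mul_nonsing_inv _ hsu, Matrix.one_mul,
      ← Matrix.mul_assoc s⁻¹ s, nonsing_inv_mul _ hsu, Matrix.one_mul, hUU]
  set X := Uᵀ * s * L * (s⁻¹ * U) with hX
  have htr : X.trace = L.trace := by
    rw [hX, trace_mul_comm]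
    have : s⁻¹ * U * (Uᵀ * s * L) = L := by
      simp only [Matrix.mul_assoc]
      rw [← Matrix.mul_assoc U, hUU', Matrix.one_mul, ← Matrix.mul_assoc, nonsing_inv_mul _ hsu,
        Matrix.one_mul]
    rw [this]
  have hX' : Uᵀ * s⁻¹ * Lᵀ * (s * U) = Xᵀ := by
    simp [hX, transpose_mul, hsT, hsiT, Matrix.mul_assoc]
  rw [h11, h22, hX'] at hB
  have hHtr : H.trace = ∑ i, hHp.1.eigenvalues i := by
    simpa using hHp.1.trace_eq_sum_eigenvalues
  rw [← htr, hHtr, trace, ← Finset.sum_neg_distrib]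
  refine Finset.sum_le_sum fun i _ => ?_
  -- The lower entry `-X i i` minimises the quadratic form for the upper entry `1`. The value is
  -- `d_i² - X_ii²`.
  have h5 := hB.dotProduct_mulVec_nonneg (Sum.elim (Pi.single i 1) (Pi.single i (-X i i)))
  simp only [fromBlocks_mulVec, star_trivial, Sum.elim_comp_inl, Sum.elim_comp_inr, mulVec_single] at h5
  simp [dotProduct_block] at h5
  exact (abs_le.1 (abs_le_of_sq_le_sq (by rw [sq (X.diag i)]; exact h5) (hHp.eigenvalues_nonneg i))).1

/-- This is the congruence of `S` by the block column of `B` and `1`. It makes every transition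
matrix a feasible point of the matrix inequality. -/
theorem PosSemidef.fromBlocks_of_mul {m : Type*} [Fintype m] [DecidableEq m] {S : Matrix n n ℝ}
    (hS : S.PosSemidef) (B : Matrix m n ℝ) :
    (fromBlocks (B * S * Bᵀ) (B * S) (B * S)ᵀ S).PosSemidef := by
  have := hS.mul_mul_transpose_same (fromRows B (1 : Matrix n n ℝ))
  rw [fromRows_mul, transpose_fromRows, fromRows_mul_fromCols] at this
  have hST : Sᵀ = S := hS.1
  simpa [hST] using this

/-- With `s = S₀^{1/2}` and `g = S₁^{1/2}`, every orthogonal `V` gives a congruence `F = -g V s⁻¹`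
from `S₀` to `S₁`, and `tr (Θ F S₀) = -tr (s Θ g V)`. The orthogonal factor in the polar
decomposition of `s Θ g` turns this into the trace of a square root. Only `S₀` is inverted, so `S₁`
may be singular. -/
theorem exists_congruence_trace_eq {S₀ S₁ : Matrix n n ℝ} (h₀ : S₀.PosDef) (h₁ : S₁.PosSemidef)
    (Θ : Matrix n n ℝ) : ∃ F : Matrix n n ℝ, F * S₀ * Fᵀ = S₁ ∧
      (Θ * F * S₀).trace =
        -(CFC.sqrt (CFC.sqrt S₀ * (Θ * S₁ * Θᵀ) * CFC.sqrt S₀)).trace := by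
  set s := CFC.sqrt S₀ with hs
  set g := CFC.sqrt S₁ with hg
  have hsu : IsUnit s.det := h₀.isUnit_det_cfcSqrt
  have hsT : sᵀ = s := transpose_cfcSqrt _
  have hgT : gᵀ = g := transpose_cfcSqrt _
  have hss : s * s = S₀ := h₀.posSemidef.cfcSqrt_mul_self
  have hgg : g * g = S₁ := h₁.cfcSqrt_mul_self
  have hsiT : s⁻¹ᵀ = s⁻¹ := by rw [transpose_nonsing_inv, hsT]
  obtain ⟨V, hV, hAV⟩ := exists_orthogonal_mul_eq_cfcSqrt (s * Θ * g)
  have h1 : s * Θ * g * (s * Θ * g)ᵀ = s * (Θ * S₁ * Θᵀ) * s := by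
    simp only [transpose_mul, hsT, hgT, ← hgg, Matrix.mul_assoc]
  have hFs : -(g * V * s⁻¹) * S₀ = -(g * V * s) := by
    rw [← hss, Matrix.neg_mul, Matrix.mul_assoc (g * V), ← Matrix.mul_assoc s⁻¹,
      nonsing_inv_mul _ hsu, Matrix.one_mul]
  refine ⟨-(g * V * s⁻¹), ?_, ?_⟩
  · rw [hFs, transpose_neg, Matrix.neg_mul, Matrix.mul_neg, neg_neg]
    simp only [transpose_mul, hsiT, hgT, Matrix.mul_assoc]
    rw [← Matrix.mul_assoc s, mul_nonsing_inv _ hsu, Matrix.one_mul, ← Matrix.mul_assoc V, hV,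
      Matrix.one_mul, hgg]
  · rw [Matrix.mul_assoc, hFs, Matrix.mul_neg, trace_neg, ← h1, ← hAV]
    congr 1
    rw [← Matrix.mul_assoc, trace_mul_comm]
    simp only [Matrix.mul_assoc]

end Matrix

/-- An optimal congruence `F` gives a positive semidefinite block matrix with off-diagonal block `F
* Sy`. Compressing it by `[1, 1]` and taking the trace yields the covariance part of the distance.
-/
theorem gaussW2Sq_nonneg {n : ℕ} (μx μy : Fin n → ℝ) {Sx Sy : Matrix (Fin n) (Fin n) ℝ}
    (hx : Sx.PosSemidef) (hy : Sy.PosDef) : 0 ≤ gaussW2Sq μx Sx μy Sy := by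
  obtain ⟨F, hF, hFt⟩ := exists_congruence_trace_eq hy hx 1
  have h := hy.posSemidef.fromBlocks_of_mul F
  rw [hF] at h
  have h2 := (h.mul_mul_transpose_same (fromCols (1 : Matrix (Fin n) (Fin n) ℝ) (1 : Matrix (Fin n) (Fin n) ℝ))).trace_nonneg
  rw [transpose_fromCols, fromCols_mul_fromBlocks, fromCols_mul_fromRows] at h2
  simp only [Matrix.one_mul, transpose_one, Matrix.mul_one, trace_add, trace_transpose] at h2
  simp only [Matrix.one_mul, transpose_one, Matrix.mul_one] at hFt
  rw [gaussW2Sq, trace_add]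
  have h3 : 0 ≤ (μx - μy) ⬝ᵥ (μx - μy) := dotProduct_self_star_nonneg (μx - μy)
  linarith

/-! ### Quadratic and trace forms -/

namespace Matrix

theorem dotProduct_blockDiagonal_mulVec {ι κ : Type*} [Fintype ι] [Fintype κ] [DecidableEq κ]
    (W : κ → Matrix ι ι ℝ) (v w : ι × κ → ℝ) :
    v ⬝ᵥ (blockDiagonal W *ᵥ w) =
      ∑ k, (fun a => v (a, k)) ⬝ᵥ (W k *ᵥ fun a => w (a, k)) := by
  have h : ∀ a k, (blockDiagonal W *ᵥ w) (a, k) = (W k *ᵥ fun a => w (a, k)) a := by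
    intro a k
    simp [mulVec, dotProduct, Fintype.sum_prod_type, blockDiagonal_apply]
  simp only [dotProduct, Fintype.sum_prod_type_right, h]

theorem PosSemidef.blockDiagonal {ι κ : Type*} [Fintype ι] [Fintype κ] [DecidableEq κ]
    {W : κ → Matrix ι ι ℝ} (hW : ∀ k, (W k).PosSemidef) :
    (Matrix.blockDiagonal W).PosSemidef := by
  refine .of_dotProduct_mulVec_nonneg ?_ fun x => ?_
  · rw [IsHermitian, blockDiagonal_conjTranspose]
    exact congrArg _ (funext fun k => (hW k).1)
  · rw [dotProduct_blockDiagonal_mulVec]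
    exact Finset.sum_nonneg fun k _ => (hW k).dotProduct_mulVec_nonneg _

theorem PosDef.blockDiagonal {ι κ : Type*} [Fintype ι] [Fintype κ] [DecidableEq κ]
    {W : κ → Matrix ι ι ℝ} (hW : ∀ k, (W k).PosDef) :
    (Matrix.blockDiagonal W).PosDef := by
  refine .of_dotProduct_mulVec_pos
    (PosSemidef.blockDiagonal fun k => (hW k).posSemidef).1 fun x hx => ?_
  rw [dotProduct_blockDiagonal_mulVec]
  obtain ⟨⟨a, k⟩, hak⟩ := Function.ne_iff.1 hx
  exact Finset.sum_pos' (fun k _ => (hW k).posSemidef.dotProduct_mulVec_nonneg _)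
    ⟨k, Finset.mem_univ _, (hW k).dotProduct_mulVec_pos fun h => hak (congrFun h a)⟩

/-- A quadratic form at a sum. -/
theorem IsSymm.dotProduct_mulVec_add {ι : Type*} [Fintype ι] {W : Matrix ι ι ℝ} (hW : Wᵀ = W)
    (a b : ι → ℝ) : (a + b) ⬝ᵥ (W *ᵥ (a + b)) =
      a ⬝ᵥ (W *ᵥ a) + 2 * (b ⬝ᵥ (W *ᵥ a)) + b ⬝ᵥ (W *ᵥ b) := by
  have h : a ⬝ᵥ (W *ᵥ b) = b ⬝ᵥ (W *ᵥ a) := by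
    rw [dotProduct_mulVec, ← mulVec_transpose, hW, dotProduct_comm]
  rw [mulVec_add, add_dotProduct, dotProduct_add, dotProduct_add, h]
  ring

/-- The trace form of a sum. -/
theorem trace_mul_add_mul_transpose {ι κ : Type*} [Fintype ι] [Fintype κ] {W : Matrix ι ι ℝ}
    (hW : Wᵀ = W) {S : Matrix κ κ ℝ} (hS : Sᵀ = S) (a b : Matrix ι κ ℝ) :
    (W * (a + b) * S * (a + b)ᵀ).trace =
      (W * a * S * aᵀ).trace + 2 * (W * a * S * bᵀ).trace + (W * b * S * bᵀ).trace := by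
  have h : (W * b * S * aᵀ).trace = (W * a * S * bᵀ).trace := by
    rw [← trace_transpose, trace_mul_comm (W * a * S)]
    simp only [transpose_mul, transpose_transpose, hW, hS]
    rw [trace_mul_comm a, trace_mul_comm bᵀ]
    simp only [Matrix.mul_assoc]
    rw [trace_mul_comm S]
    simp only [Matrix.mul_assoc]
    rw [trace_mul_comm bᵀ]
    simp only [Matrix.mul_assoc]
  simp only [Matrix.mul_add, transpose_add, Matrix.add_mul, trace_add, h]
  ring

theorem trace_mul_mul_mul_transpose_nonneg {ι κ : Type*} [Fintype ι] [Fintype κ]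
    {W : Matrix ι ι ℝ} (hW : W.PosSemidef) {S : Matrix κ κ ℝ} (hS : S.PosSemidef)
    (a : Matrix ι κ ℝ) : 0 ≤ (W * a * S * aᵀ).trace := by
  classical
  obtain ⟨B, rfl⟩ : ∃ B : Matrix κ κ ℝ, S = B * Bᵀ :=
    ⟨CFC.sqrt S, by rw [transpose_cfcSqrt, hS.cfcSqrt_mul_self]⟩
  have h := (hW.conjTranspose_mul_mul_same (a * B)).trace_nonneg
  rw [Matrix.mul_assoc, trace_mul_comm] at h
  simpa [conjTranspose_eq_transpose_of_trivial, transpose_mul, Matrix.mul_assoc] using h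

end Matrix

/-! ### Stacked dynamics and the steering subproblems -/

namespace SteeringData

variable {n m N r t : ℕ} (P : SteeringData n m N r t)

theorem Φ_self (k : ℕ) : P.Φ k k = 1 := by
  cases k <;> simp [Φ]

theorem Φ_succ {k l : ℕ} (h : l ≤ k) : P.Φ (k + 1) l = P.A k * P.Φ k l := by
  simp [Φ, h]

theorem traj_eq (x : Fin n → ℝ) (U : Fin m × Fin N → ℝ) (k : ℕ) :
    P.traj x U k = P.Φ k 0 *ᵥ x +
      ∑ l ∈ Finset.range k, (P.Φ k (l + 1) * P.B l) *ᵥ ctrl U l := by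
  induction k with
  | zero => simp [traj, Φ]
  | succ k ih =>
    rw [traj, ih, Finset.sum_range_succ, Φ_self, Matrix.one_mul, P.Φ_succ (Nat.zero_le k),
      mulVec_add, mulVec_mulVec, mulVec_sum, add_assoc]
    congr 2
    refine Finset.sum_congr rfl fun l hl => ?_
    rw [P.Φ_succ (Finset.mem_range.1 hl), mulVec_mulVec, Matrix.mul_assoc]

theorem ctrl_coe (U : Fin m × Fin N → ℝ) (k : Fin N) : ctrl U k = fun a => U (a, k) := by
  funext a
  simp [ctrl]

theorem traj_terminal (x : Fin n → ℝ) (U : Fin m × Fin N → ℝ) :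
    P.traj x U N = P.Φ N 0 *ᵥ x + P.BN *ᵥ U := by
  rw [traj_eq]
  congr 1
  funext a
  rw [Finset.sum_apply, ← Fin.sum_univ_eq_sum_range
    (fun l => ((P.Φ N (l + 1) * P.B l) *ᵥ ctrl U l) a)]
  simp only [ctrl_coe, mulVec, dotProduct, Fintype.sum_prod_type_right, BN, of_apply]

theorem stacked_traj (x : Fin n → ℝ) (U : Fin m × Fin N → ℝ) (a : Fin n) (k : Fin (N + 1)) :
    (P.Γ *ᵥ x + P.Hu *ᵥ U) (a, k) = P.traj x U k a := by
  rw [traj_eq, Pi.add_apply, Pi.add_apply]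
  congr 1
  have hk : (k : ℕ) ≤ N := Nat.lt_succ_iff.1 k.2
  have h1 : Finset.range (k : ℕ) = (Finset.range N).filter (fun l => l < (k : ℕ)) := by
    ext l; simp; omega
  rw [Finset.sum_apply, h1, Finset.sum_filter, ← Fin.sum_univ_eq_sum_range
    (fun l => if l < (k : ℕ) then ((P.Φ k (l + 1) * P.B l) *ᵥ ctrl U l) a else 0)]
  simp only [ctrl_coe, mulVec, dotProduct, Fintype.sum_prod_type_right, Hu, of_apply, ite_mul,
    zero_mul]
  refine Finset.sum_congr rfl fun l _ => ?_
  split_ifs <;> simp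

/-- The mean steering objective, evaluated at an arbitrary initial state, is the pathwise cost.
Expected costs can therefore be computed with the stacked matrices. -/
theorem cost_eq_Jmean (x : Fin n → ℝ) (U : Fin m × Fin N → ℝ) : P.cost x U = P.Jmean x U := by
  rw [cost, Jmean, Rb, Qb, dotProduct_blockDiagonal_mulVec, dotProduct_blockDiagonal_mulVec,
    Fin.sum_univ_castSucc]
  have h : ∀ k : Fin (N + 1), (fun a => (P.Γ *ᵥ x + P.Hu *ᵥ U - P.Xref) (a, k)) =
      P.traj x U k - P.xref k := by
    intro k
    funext a
    rw [Pi.sub_apply, stacked_traj]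
    rfl
  simp only [h, Fin.val_last, Fin.val_castSucc, ← ctrl_coe]
  rw [Finset.sum_add_distrib, Fin.sum_univ_eq_sum_range
    (fun k => ctrl U k ⬝ᵥ (P.R k *ᵥ ctrl U k)), Fin.sum_univ_eq_sum_range
    (fun k => (P.traj x U k - P.xref k) ⬝ᵥ (P.Q k *ᵥ (P.traj x U k - P.xref k)))]
  ring

theorem gramian_eq : P.gramian = P.BN * P.BNᵀ := by
  ext a b
  rw [gramian, Matrix.sum_apply, ← Fin.sum_univ_eq_sum_range
    (fun k => (P.Φ N (k + 1) * P.B k * (P.B k)ᵀ * (P.Φ N (k + 1))ᵀ) a b), mul_apply,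
    Fintype.sum_prod_type_right]
  refine Finset.sum_congr rfl fun k _ => ?_
  rw [Matrix.mul_assoc, ← transpose_mul, mul_apply]
  rfl

theorem gramian_transpose : P.gramianᵀ = P.gramian := by
  rw [gramian_eq, transpose_mul, transpose_transpose]

variable {P}

namespace Standing

variable (hP : P.Standing)
include hP

theorem Rb_posDef : P.Rb.PosDef := PosDef.blockDiagonal fun k => hP.R_posDef k k.2

theorem Qb_posSemidef : P.Qb.PosSemidef :=
  PosSemidef.blockDiagonal fun k => hP.Q_posSemidef k (Nat.lt_succ_iff.1 k.2)

theorem Rb_transpose : P.Rbᵀ = P.Rb := hP.Rb_posDef.1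

theorem Qb_transpose : P.Qbᵀ = P.Qb := hP.Qb_posSemidef.1

theorem M_posDef : P.M.PosDef := by
  refine hP.Rb_posDef.add_posSemidef ?_
  simpa using hP.Qb_posSemidef.conjTranspose_mul_mul_same P.Hu

theorem M_isUnit : IsUnit P.M.det := isUnit_iff_ne_zero.2 hP.M_posDef.det_pos.ne'

theorem BN_vecMul_injective : Function.Injective P.BN.vecMul := by
  refine Function.LeftInverse.injective (g := fun v => v ᵥ* (P.BNᵀ * P.gramian⁻¹)) fun v => ?_
  simp only [vecMul_vecMul]
  rw [← Matrix.mul_assoc, ← gramian_eq, mul_nonsing_inv _ hP.controllable, vecMul_one]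

theorem BN_M_isUnit : IsUnit (P.BN * P.M⁻¹ * P.BNᵀ).det := by
  have h := hP.M_posDef.inv.mul_mul_conjTranspose_same hP.BN_vecMul_injective
  exact isUnit_iff_ne_zero.2 h.det_pos.ne'

theorem Jmean_nonneg (μ : Fin n → ℝ) (U : Fin m × Fin N → ℝ) : 0 ≤ P.Jmean μ U :=
  add_nonneg (hP.Rb_posDef.posSemidef.dotProduct_mulVec_nonneg _)
    (hP.Qb_posSemidef.dotProduct_mulVec_nonneg _)

/-- Exact second-order expansion with Hessian `2M`. The vector paired with `δ` in the last term is
half the gradient at `U`. -/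
theorem Jmean_add (μ : Fin n → ℝ) (U δ : Fin m × Fin N → ℝ) :
    P.Jmean μ (U + δ) = P.Jmean μ U + δ ⬝ᵥ (P.M *ᵥ δ) +
      2 * (δ ⬝ᵥ (P.M *ᵥ U + (P.Huᵀ * P.Qb) *ᵥ (P.Γ *ᵥ μ - P.Xref))) := by
  have h1 : P.Γ *ᵥ μ + P.Hu *ᵥ (U + δ) - P.Xref =
      (P.Γ *ᵥ μ + P.Hu *ᵥ U - P.Xref) + P.Hu *ᵥ δ := by rw [mulVec_add]; abel
  have h2 : P.Γ *ᵥ μ + P.Hu *ᵥ U - P.Xref = (P.Γ *ᵥ μ - P.Xref) + P.Hu *ᵥ U := by abel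
  have h3 : ∀ w, (P.Hu *ᵥ δ) ⬝ᵥ (P.Qb *ᵥ w) = δ ⬝ᵥ ((P.Huᵀ * P.Qb) *ᵥ w) := by
    intro w
    rw [← mulVec_mulVec, dotProduct_mulVec δ, vecMul_transpose]
  rw [Jmean, Jmean, h1, IsSymm.dotProduct_mulVec_add hP.Rb_transpose,
    IsSymm.dotProduct_mulVec_add hP.Qb_transpose, h3, h3, h2, M]
  simp only [add_mulVec, mulVec_add, dotProduct_add, mulVec_mulVec, Matrix.mul_assoc]
  ring

/-- Half the gradient at `Ustar` is `½ B_Nᵀ Λ`, which is orthogonal to every admissible direction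
`δ` because `B_N δ = 0`. Positivity of `M` gives minimality, and the multiplier is the one that
meets the terminal constraint. -/
theorem solvesMean_Ustar (μ₀ μ₁ : Fin n → ℝ) : P.SolvesMean μ₀ μ₁ (P.Ustar μ₀ μ₁) := by
  have hf : P.Ustar μ₀ μ₁ ∈ P.meanFeasible μ₀ μ₁ := by
    have h1 : P.BN *ᵥ P.Ustar μ₀ μ₁ = μ₁ - P.Φ N 0 *ᵥ μ₀ := by
      rw [Ustar, multStar]
      simp only [mulVec_smul, mulVec_sub, smul_sub, mulVec_mulVec, smul_smul]
      norm_num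
      simp only [← Matrix.mul_assoc]
      rw [mul_nonsing_inv _ hP.BN_M_isUnit, one_mulVec]
      simp
    rw [meanFeasible, Set.mem_ofPred_eq, h1]
    abel
  refine ⟨hf, fun U hU => ?_⟩
  set δ := U - P.Ustar μ₀ μ₁ with hδ
  have hBδ : P.BN *ᵥ δ = 0 := by
    have h1 : μ₁ = P.Φ N 0 *ᵥ μ₀ + P.BN *ᵥ U := hU
    have h2 : μ₁ = P.Φ N 0 *ᵥ μ₀ + P.BN *ᵥ P.Ustar μ₀ μ₁ := hf
    rw [hδ, mulVec_sub, sub_eq_zero]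
    exact add_left_cancel (h1.symm.trans h2)
  have hg : P.M *ᵥ P.Ustar μ₀ μ₁ + (P.Huᵀ * P.Qb) *ᵥ (P.Γ *ᵥ μ₀ - P.Xref) =
      (1 / 2 : ℝ) • (P.BNᵀ *ᵥ P.multStar μ₀ μ₁) := by
    rw [Ustar, mulVec_smul, mulVec_mulVec, mul_nonsing_inv _ hP.M_isUnit, one_mulVec, smul_sub,
      smul_smul]
    norm_num
  have hz : δ ⬝ᵥ (P.M *ᵥ P.Ustar μ₀ μ₁ + (P.Huᵀ * P.Qb) *ᵥ (P.Γ *ᵥ μ₀ - P.Xref)) = 0 := by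
    rw [hg, dotProduct_smul, dotProduct_mulVec, vecMul_transpose, hBδ, zero_dotProduct, smul_zero]
  have hU' : U = P.Ustar μ₀ μ₁ + δ := by rw [hδ]; abel
  have hM : 0 ≤ δ ⬝ᵥ (P.M *ᵥ δ) := hP.M_posDef.posSemidef.dotProduct_mulVec_nonneg δ
  change P.Jmean μ₀ (P.Ustar μ₀ μ₁) ≤ P.Jmean μ₀ U
  rw [hU', hP.Jmean_add, hz]
  linarith

theorem Jmean_eq_JmeanStar {μ₀ μ₁ : Fin n → ℝ} {U : Fin m × Fin N → ℝ}
    (hU : P.SolvesMean μ₀ μ₁ U) : P.Jmean μ₀ U = P.JmeanStar μ₀ μ₁ :=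
  le_antisymm (hU.2 (hP.solvesMean_Ustar μ₀ μ₁).1) ((hP.solvesMean_Ustar μ₀ μ₁).2 hU.1)

theorem JmeanStar_le {μ₀ μ₁ : Fin n → ℝ} {U : Fin m × Fin N → ℝ}
    (hU : U ∈ P.meanFeasible μ₀ μ₁) : P.JmeanStar μ₀ μ₁ ≤ P.Jmean μ₀ U :=
  (hP.solvesMean_Ustar μ₀ μ₁).2 hU

theorem Jcov_nonneg {S : Matrix (Fin n) (Fin n) ℝ} (hS : S.PosSemidef)
    (L : Matrix (Fin m × Fin N) (Fin n) ℝ) : 0 ≤ P.Jcov S L :=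
  add_nonneg (trace_mul_mul_mul_transpose_nonneg hP.Rb_posDef.posSemidef hS _)
    (trace_mul_mul_mul_transpose_nonneg hP.Qb_posSemidef hS _)

theorem Jcov_add {S : Matrix (Fin n) (Fin n) ℝ} (hS : Sᵀ = S)
    (L δ : Matrix (Fin m × Fin N) (Fin n) ℝ) :
    P.Jcov S (L + δ) = P.Jcov S L + (P.M * δ * S * δᵀ).trace +
      2 * ((P.M * L + P.Huᵀ * P.Qb * P.Γ) * S * δᵀ).trace := by
  have h1 : P.Γ + P.Hu * (L + δ) = (P.Γ + P.Hu * L) + P.Hu * δ := by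
    rw [Matrix.mul_add]; abel
  have h2 : ∀ X : Matrix (Fin n × Fin (N + 1)) (Fin n) ℝ,
      (P.Qb * X * S * (P.Hu * δ)ᵀ).trace = (P.Huᵀ * P.Qb * X * S * δᵀ).trace := by
    intro X
    rw [transpose_mul, ← Matrix.mul_assoc, trace_mul_comm]
    simp only [Matrix.mul_assoc]
  rw [Jcov, Jcov, h1, trace_mul_add_mul_transpose hP.Rb_transpose hS,
    trace_mul_add_mul_transpose hP.Qb_transpose hS, h2, h2, M]
  simp only [Matrix.add_mul, Matrix.mul_add, trace_add, Matrix.mul_assoc]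
  ring

/-! ### Optimal gains with a prescribed transition matrix and covariance steering -/

section Theta

variable {d : ℕ} {D : Matrix (Fin m × Fin N) (Fin d) ℝ}

theorem DMD_isUnit (hD : D.rank = d) : IsUnit (Dᵀ * P.M * D).det := by
  have hinj : Function.Injective D.mulVec := by
    rw [mulVec_injective_iff, linearIndependent_iff_card_eq_finrank_span, Fintype.card_fin,
      Set.finrank, ← rank_eq_finrank_span_cols, hD]
  have h := hP.M_posDef.conjTranspose_mul_mul_same hinj
  exact isUnit_iff_ne_zero.2 h.det_pos.ne'

/-- `Θ₁` is the `M`-orthogonal projection along the range of `D`, so the part of a gain that passes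
through it is stationary in the directions `D W`. -/
theorem DMΘ₁_eq_zero (hD : D.rank = d) : Dᵀ * P.M * P.Θ₁ D = 0 := by
  have h : Dᵀ * P.M * (D * (Dᵀ * P.M * D)⁻¹ * Dᵀ * P.M) = Dᵀ * P.M := by
    simp only [← Matrix.mul_assoc]
    rw [mul_nonsing_inv _ (hP.DMD_isUnit hD), Matrix.one_mul]
  rw [Θ₁, Matrix.mul_sub, Matrix.mul_one, h, sub_self]

/-- `Θ₂` is the correction that cancels the constant term `H_uᵀ Q Γ` of the gradient of `Jcov` in
the directions `D W`. -/
theorem DMΘ₂_eq (hD : D.rank = d) : Dᵀ * P.M * P.Θ₂ D = Dᵀ * P.Huᵀ * P.Qb * P.Γ := by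
  rw [Θ₂]
  simp only [← Matrix.mul_assoc]
  rw [mul_nonsing_inv _ (hP.DMD_isUnit hD), Matrix.one_mul]

omit hP in
theorem BN_mul_Θ₁ (hBD : P.BN * D = 0) : P.BN * P.Θ₁ D = P.BN := by
  rw [Θ₁, Matrix.mul_sub, Matrix.mul_one]
  simp only [← Matrix.mul_assoc, hBD, Matrix.zero_mul, sub_zero]

omit hP in
theorem BN_mul_Θ₂ (hBD : P.BN * D = 0) : P.BN * P.Θ₂ D = 0 := by
  rw [Θ₂]
  simp only [← Matrix.mul_assoc, hBD, Matrix.zero_mul]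

/-- The gain with closed-loop transition matrix `F` that is optimal among all such gains. -/
noncomputable def _root_.SteeringData.gainOf (P : SteeringData n m N r t)
    (D : Matrix (Fin m × Fin N) (Fin d) ℝ) (F : Matrix (Fin n) (Fin n) ℝ) :
    Matrix (Fin m × Fin N) (Fin n) ℝ :=
  P.Θ₁ D * P.BNᵀ * P.gramian⁻¹ * F - P.Θ₄ D

theorem transition_gainOf (hBD : P.BN * D = 0) (F : Matrix (Fin n) (Fin n) ℝ) :
    P.Φ N 0 + P.BN * P.gainOf D F = F := by
  have h1 : P.BN * (P.Θ₁ D * P.BNᵀ * P.gramian⁻¹ * F) = F := by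
    simp only [← Matrix.mul_assoc]
    rw [BN_mul_Θ₁ hBD, ← gramian_eq, mul_nonsing_inv _ hP.controllable, Matrix.one_mul]
  have h2 : P.BN * P.Θ₄ D = P.Φ N 0 := by
    rw [Θ₄, Matrix.mul_add, BN_mul_Θ₂ hBD, add_zero, Θ₃]
    simp only [← Matrix.mul_assoc]
    rw [BN_mul_Θ₁ hBD, ← gramian_eq, mul_nonsing_inv _ hP.controllable, Matrix.one_mul]
  rw [gainOf, Matrix.mul_sub, h1, h2]
  abel

/-- With `K = Θ₁ B_Nᵀ 𝒢⁻¹` the gain is `K F - Θ₄`, and `Γ + H_u L` becomes `Θ₅ + H_u K F`. In the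
expansion in `F`, the quadratic part is governed by `Θ₆ = Kᵀ M K`, the constant part by `Θ₇` and the
cross terms by `Θ₈`. -/
theorem Jcov_gainOf {S : Matrix (Fin n) (Fin n) ℝ} (hS : Sᵀ = S)
    (F : Matrix (Fin n) (Fin n) ℝ) :
    P.Jcov S (P.gainOf D F) = (P.Θ₆ D * (F * S * Fᵀ)).trace + (P.Θ₇ D * S).trace +
      2 * (P.Θ₈ D * F * S).trace := by
  set K := P.Θ₁ D * P.BNᵀ * P.gramian⁻¹ with hK
  have hg : P.gainOf D F = -P.Θ₄ D + K * F := by rw [gainOf, hK]; abel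
  have h1 : P.Γ + P.Hu * (-P.Θ₄ D + K * F) = P.Θ₅ D + P.Hu * K * F := by
    rw [Θ₅, Matrix.mul_add, Matrix.mul_neg, ← Matrix.mul_assoc]; abel
  have h6 : P.Θ₆ D = Kᵀ * P.M * K := by
    rw [Θ₆, hK]
    simp only [transpose_mul, transpose_nonsing_inv, gramian_transpose, transpose_transpose,
      Matrix.mul_assoc]
  have h8 : P.Θ₈ D = ((P.Θ₅ D)ᵀ * P.Qb * P.Hu - (P.Θ₄ D)ᵀ * P.Rb) * K := by
    rw [Θ₈, hK]
    simp only [Matrix.mul_assoc]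
  have e2 : ∀ {ι : Type} [Fintype ι] {W : Matrix ι ι ℝ} (_ : Wᵀ = W) (X Y : Matrix ι (Fin n) ℝ),
      (W * X * S * Yᵀ).trace = (Xᵀ * W * Y * S).trace := by
    intro ι _ W hW X Y
    rw [← trace_transpose]
    simp only [transpose_mul, transpose_transpose, hW, hS]
    rw [trace_mul_comm]
    simp only [Matrix.mul_assoc]
    rw [trace_mul_comm]
    simp only [Matrix.mul_assoc]
  rw [Jcov, hg, h1, trace_mul_add_mul_transpose hP.Rb_transpose hS,
    trace_mul_add_mul_transpose hP.Qb_transpose hS, h6, h8, Θ₇, M]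
  simp only [e2 hP.Rb_transpose, e2 hP.Qb_transpose]
  have e3 : (Kᵀ * (P.Rb + P.Huᵀ * P.Qb * P.Hu) * K * (F * S * Fᵀ)).trace =
      ((K * F)ᵀ * P.Rb * (K * F) * S).trace +
        ((P.Hu * K * F)ᵀ * P.Qb * (P.Hu * K * F) * S).trace := by
    rw [← Matrix.mul_assoc, trace_mul_comm]
    simp only [transpose_mul, Matrix.add_mul, Matrix.mul_add, trace_add, Matrix.mul_assoc]
  rw [e3]
  simp only [Matrix.add_mul, Matrix.sub_mul, trace_add, trace_sub, Matrix.mul_assoc,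
    transpose_neg, Matrix.neg_mul, Matrix.mul_neg, neg_neg, trace_neg]
  ring

end Theta

variable {D : Matrix (Fin m × Fin N) (Fin (m * N - n)) ℝ}

/-- The range of `D` lies in the kernel of `B_N`. The Gramian makes `B_N` surjective, so its kernel
has dimension `mN - n`, which is the rank of `D`, and the two spaces coincide. Rank-nullity also
shows `n ≤ mN`, so the natural-number subtraction is exact. -/
theorem exists_eq_mul_of_BN_mul_eq_zero (hD : D.rank = m * N - n) (hBD : P.BN * D = 0)
    {δ : Matrix (Fin m × Fin N) (Fin n) ℝ} (hδ : P.BN * δ = 0) :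
    ∃ W : Matrix (Fin (m * N - n)) (Fin n) ℝ, δ = D * W := by
  have hle : LinearMap.range D.mulVecLin ≤ LinearMap.ker P.BN.mulVecLin := by
    rintro _ ⟨w, rfl⟩
    rw [LinearMap.mem_ker, mulVecLin_apply, mulVecLin_apply, mulVec_mulVec, hBD, zero_mulVec]
  have hrank : Module.finrank ℝ (LinearMap.range P.BN.mulVecLin) = n := by
    have : LinearMap.range P.BN.mulVecLin = ⊤ := by
      refine LinearMap.range_eq_top.2 fun y => ⟨P.BNᵀ *ᵥ (P.gramian⁻¹ *ᵥ y), ?_⟩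
      rw [mulVecLin_apply, mulVec_mulVec, mulVec_mulVec, ← gramian_eq,
        mul_nonsing_inv _ hP.controllable, one_mulVec]
    rw [this, finrank_top, Module.finrank_fin_fun]
  have hsum := LinearMap.finrank_range_add_finrank_ker P.BN.mulVecLin
  rw [hrank, Module.finrank_fintype_fun_eq_card, Fintype.card_prod, Fintype.card_fin,
    Fintype.card_fin] at hsum
  have heq := Submodule.eq_of_le_of_finrank_eq hle (by
    have : Module.finrank ℝ (LinearMap.range D.mulVecLin) = m * N - n := hD
    omega)
  have hcol : ∀ b, ∃ w, D *ᵥ w = fun a => δ a b := by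
    intro b
    have : (fun a => δ a b) ∈ LinearMap.range D.mulVecLin := by
      rw [heq, LinearMap.mem_ker]
      funext a
      exact congrFun (congrFun hδ a) b
    exact this
  choose w hw using hcol
  refine ⟨of fun k b => w b k, ?_⟩
  ext a b
  exact (congrFun (hw b) a).symm

/-- Two gains with the same transition matrix differ by some `D W`. The gradient at `gainOf` is
annihilated by `Dᵀ`, so the excess cost is the nonnegative term `tr (M (DW) S (DW)ᵀ)`. -/
theorem Jcov_gainOf_le (hD : D.rank = m * N - n) (hBD : P.BN * D = 0)
    {S : Matrix (Fin n) (Fin n) ℝ} (hS : S.PosSemidef)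
    (L : Matrix (Fin m × Fin N) (Fin n) ℝ) :
    P.Jcov S (P.gainOf D (P.Φ N 0 + P.BN * L)) ≤ P.Jcov S L := by
  have hST : Sᵀ = S := hS.1
  set F := P.Φ N 0 + P.BN * L with hF
  obtain ⟨W, hW⟩ := hP.exists_eq_mul_of_BN_mul_eq_zero hD hBD (δ := L - P.gainOf D F) (by
    rw [Matrix.mul_sub, sub_eq_zero]
    have := hP.transition_gainOf hBD F
    conv_rhs at this => rw [hF]
    exact (add_left_cancel this).symm)
  have hL : L = P.gainOf D F + D * W := by rw [← hW]; abel
  have hg : Dᵀ * (P.M * P.gainOf D F + P.Huᵀ * P.Qb * P.Γ) = 0 := by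
    clear_value F
    rw [gainOf, Θ₄, Matrix.mul_add]
    simp only [Matrix.mul_sub, Matrix.mul_add, ← Matrix.mul_assoc]
    rw [hP.DMΘ₁_eq_zero hD, hP.DMΘ₂_eq hD]
    simp
  have hz : ((P.M * P.gainOf D F + P.Huᵀ * P.Qb * P.Γ) * S * (D * W)ᵀ).trace = 0 := by
    rw [transpose_mul, ← Matrix.mul_assoc, trace_mul_comm]
    simp only [← Matrix.mul_assoc]
    rw [hg]
    simp
  conv_rhs => rw [hL, hP.Jcov_add hST, hz]
  have := trace_mul_mul_mul_transpose_nonneg hP.M_posDef.posSemidef hS (D * W)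
  linarith

/-- Closed form of the optimal covariance steering cost, attained by some gain. -/
theorem exists_solvesCov (hD : D.rank = m * N - n) (hBD : P.BN * D = 0)
    {S₀ S₁ : Matrix (Fin n) (Fin n) ℝ} (h₀ : S₀.PosDef) (h₁ : S₁.PosSemidef) :
    ∃ F : Matrix (Fin n) (Fin n) ℝ, F * S₀ * Fᵀ = S₁ ∧ P.SolvesCov S₀ S₁ (P.gainOf D F) ∧
      P.Jcov S₀ (P.gainOf D F) = (P.Θ₆ D * S₁).trace + (P.Θ₇ D * S₀).trace +
        2 * (P.Θ₈ D * F * S₀).trace ∧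
      (P.Θ₈ D * F * S₀).trace =
        -(CFC.sqrt (CFC.sqrt S₀ * (P.Θ₈ D * S₁ * (P.Θ₈ D)ᵀ) * CFC.sqrt S₀)).trace := by
  obtain ⟨F, hF, hFt⟩ := exists_congruence_trace_eq h₀ h₁ (P.Θ₈ D)
  have hST : S₀ᵀ = S₀ := h₀.1
  have hv := hP.Jcov_gainOf (D := D) hST F
  rw [hF] at hv
  refine ⟨F, hF, ⟨?_, fun L hL => ?_⟩, hv, hFt⟩
  · rw [covFeasible, Set.mem_ofPred_eq, hP.transition_gainOf hBD, hF]
  · have hL' : (P.Φ N 0 + P.BN * L) * S₀ * (P.Φ N 0 + P.BN * L)ᵀ = S₁ := hL.symm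
    -- Two lower bounds are chained: `L` is replaced by the best gain with the same transition
    -- matrix, and the remaining linear term is bounded by the matrix inequality.
    refine le_trans ?_ (hP.Jcov_gainOf_le hD hBD h₀.posSemidef L)
    rw [hv, hFt, hP.Jcov_gainOf hST, hL']
    have hB := h₀.posSemidef.fromBlocks_of_mul (P.Θ₈ D * (P.Φ N 0 + P.BN * L))
    rw [transpose_mul] at hB
    have hB' : P.Θ₈ D * (P.Φ N 0 + P.BN * L) * S₀ * ((P.Φ N 0 + P.BN * L)ᵀ * (P.Θ₈ D)ᵀ) =
        P.Θ₈ D * S₁ * (P.Θ₈ D)ᵀ := by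
      rw [← hL']; simp only [Matrix.mul_assoc]
    rw [hB'] at hB
    have := neg_trace_cfcSqrt_le_trace h₀ hB
    linarith

omit hP in
theorem SolvesCov_Jcov_eq {S₀ S₁ : Matrix (Fin n) (Fin n) ℝ}
    {L : Matrix (Fin m × Fin N) (Fin n) ℝ} (hL : P.SolvesCov S₀ S₁ L) :
    P.Jcov S₀ L = P.JcovStar S₀ S₁ := by
  have : IsLeast (P.Jcov S₀ '' P.covFeasible S₀ S₁) (P.Jcov S₀ L) :=
    ⟨⟨L, hL.1, rfl⟩, by rintro _ ⟨L', hL', rfl⟩; exact hL.2 hL'⟩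
  exact this.csInf_eq.symm

end Standing

end SteeringData

/-! ### Densities, second moments and affine images of Gaussians -/

section Gaussian

open scoped RealInnerProductSpace

theorem continuous_gaussDensity {n : ℕ} (μ : Fin n → ℝ) (S : Matrix (Fin n) (Fin n) ℝ) :
    Continuous fun x : EuclideanSpace ℝ (Fin n) => gaussDensity μ S (WithLp.ofLp x) := by
  unfold gaussDensity
  simp only [dotProduct, mulVec]
  fun_prop

theorem gaussDensity_nonneg {n : ℕ} (μ : Fin n → ℝ) (S : Matrix (Fin n) (Fin n) ℝ)
    (x : Fin n → ℝ) : 0 ≤ gaussDensity μ S x := by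
  unfold gaussDensity
  positivity

theorem gaussDensity_pos {n : ℕ} (μ : Fin n → ℝ) {S : Matrix (Fin n) (Fin n) ℝ} (hS : S.PosDef)
    (x : Fin n → ℝ) : 0 < gaussDensity μ S x := by
  have := hS.det_pos
  unfold gaussDensity
  positivity

theorem gaussDensity_zero_one {n : ℕ} (x : EuclideanSpace ℝ (Fin n)) :
    gaussDensity 0 1 (WithLp.ofLp x) =
      (Real.sqrt ((2 * Real.pi) ^ n))⁻¹ * Real.exp (-(1 / 2) * ‖x‖ ^ 2) := by
  rw [gaussDensity, det_one, mul_one, inv_one, one_mulVec, sub_zero,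
    EuclideanSpace.real_norm_sq_eq, dotProduct]
  congr 2
  simp only [← sq]
  ring

namespace ProbabilityTheory

/-- Both measures are finite, so it suffices to compare characteristic functions. That of the
density is a Gaussian integral with `b = 1/2`. -/
theorem stdGaussian_eq_withDensity (n : ℕ) : stdGaussian (EuclideanSpace ℝ (Fin n)) =
    volume.withDensity fun x => ENNReal.ofReal (gaussDensity 0 1 (WithLp.ofLp x)) := by
  have hint : Integrable fun x : EuclideanSpace ℝ (Fin n) =>
      gaussDensity 0 1 (WithLp.ofLp x) := by
    have h := (GaussianFourier.integrable_cexp_neg_mul_sq_norm_add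
      (V := EuclideanSpace ℝ (Fin n)) (b := 1 / 2) (by norm_num) 0 0).re
    refine (h.const_mul (Real.sqrt ((2 * Real.pi) ^ n))⁻¹).congr (ae_of_all _ fun x => ?_)
    beta_reduce
    rw [gaussDensity_zero_one]
    have : Complex.exp (-(1 / 2) * (‖x‖ : ℂ) ^ 2 + 0 * ⟪(0 : EuclideanSpace ℝ (Fin n)), x⟫) =
        (Real.exp (-(1 / 2) * ‖x‖ ^ 2) : ℂ) := by
      push_cast; simp
    simp only [this]
    simp [-Complex.ofReal_exp]
  have := isFiniteMeasure_withDensity_ofReal hint.2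
  refine Measure.ext_of_charFun (funext fun t => ?_)
  rw [charFun_stdGaussian, charFun_apply, integral_withDensity_eq_integral_toReal_smul
    (continuous_gaussDensity 0 1).measurable.ennreal_ofReal (by simp)]
  have h1 : ∀ x : EuclideanSpace ℝ (Fin n),
      (ENNReal.ofReal (gaussDensity 0 1 (WithLp.ofLp x))).toReal •
        Complex.exp ((⟪x, t⟫ : ℝ) * Complex.I) =
      (((Real.sqrt ((2 * Real.pi) ^ n))⁻¹ : ℝ) : ℂ) *
        Complex.exp (-(1 / 2) * (‖x‖ : ℂ) ^ 2 + Complex.I * (⟪t, x⟫ : ℝ)) := by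
    intro x
    rw [ENNReal.toReal_ofReal (gaussDensity_nonneg _ _ _), gaussDensity_zero_one,
      Complex.real_smul, Complex.ofReal_mul, Complex.ofReal_exp, Complex.exp_add,
      real_inner_comm, mul_comm Complex.I]
    push_cast
    ring
  simp only [h1]
  rw [integral_const_mul, GaussianFourier.integral_cexp_neg_mul_sq_norm_add (by norm_num)]
  have h2 : ((Real.pi : ℂ) / (1 / 2)) ^ (Module.finrank ℝ (EuclideanSpace ℝ (Fin n)) / 2 : ℂ) =
      ((Real.sqrt ((2 * Real.pi) ^ n) : ℝ) : ℂ) := by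
    rw [finrank_euclideanSpace_fin, Real.sqrt_eq_rpow, ← Real.rpow_natCast, ← Real.rpow_mul
      (by positivity), Complex.ofReal_cpow (by positivity)]
    push_cast
    congr 1 <;> ring
  rw [h2, ← mul_assoc, ← Complex.ofReal_mul, inv_mul_cancel₀ (by positivity), Complex.ofReal_one,
    one_mul]
  congr 1
  rw [Complex.I_sq]
  ring

/-- The Gaussian is the image of the standard one under `x ↦ μ + S^{1/2} x`, whose Jacobian `|det
S^{1/2}|` accounts for the normalisation. The result links the Gaussian laws to the posterior
weights, which are defined by densities. -/
theorem multivariateGaussian_eq_withDensity {n : ℕ} (μ : Fin n → ℝ)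
    {S : Matrix (Fin n) (Fin n) ℝ} (hS : S.PosDef) :
    multivariateGaussian (WithLp.toLp 2 μ) S =
      volume.withDensity fun x => ENNReal.ofReal (gaussDensity μ S (WithLp.ofLp x)) := by
  set s := CFC.sqrt S with hs
  have hsu : IsUnit s.det := hS.isUnit_det_cfcSqrt
  have hsT : sᵀ = s := transpose_cfcSqrt _
  have hss : s * s = S := hS.posSemidef.cfcSqrt_mul_self
  have hsi : S⁻¹ = s⁻¹ * s⁻¹ := by rw [← hss, Matrix.mul_inv_rev]
  let f : EuclideanSpace ℝ (Fin n) →ₗ[ℝ] EuclideanSpace ℝ (Fin n) := toEuclideanLin s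
  have hdet : LinearMap.det f = s.det := by
    simp [f, toEuclideanLin]
  have hmapf : Measure.map f volume =
      ENNReal.ofReal |s.det⁻¹| • (volume : Measure (EuclideanSpace ℝ (Fin n))) := by
    rw [Measure.map_linearMap_addHaar_eq_smul_addHaar _ (by rw [hdet]; exact hsu.ne_zero), hdet]
  have hmap : Measure.map (fun x : EuclideanSpace ℝ (Fin n) =>
      WithLp.toLp 2 μ + toEuclideanCLM (𝕜 := ℝ) s x) volume =
      ENNReal.ofReal |s.det⁻¹| • (volume : Measure (EuclideanSpace ℝ (Fin n))) := by
    have h1 : (fun x : EuclideanSpace ℝ (Fin n) =>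
        WithLp.toLp 2 μ + toEuclideanCLM (𝕜 := ℝ) s x) = (fun y => WithLp.toLp 2 μ + y) ∘ f := rfl
    rw [h1, ← Measure.map_map (by fun_prop) (LinearMap.continuous_of_finiteDimensional f).measurable,
      hmapf, Measure.map_smul, map_add_left_eq_self]
  rw [multivariateGaussian, stdGaussian_eq_withDensity]
  have hm : Measurable fun x : EuclideanSpace ℝ (Fin n) =>
      WithLp.toLp 2 μ + toEuclideanCLM (𝕜 := ℝ) s x := by fun_prop
  ext A hA
  rw [Measure.map_apply hm hA, withDensity_apply _ (hm hA), withDensity_apply _ hA]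
  have hpt : ∀ x : EuclideanSpace ℝ (Fin n),
      ENNReal.ofReal (gaussDensity 0 1 (WithLp.ofLp x)) =
      ENNReal.ofReal |s.det| * ENNReal.ofReal (gaussDensity μ S (WithLp.ofLp
        (WithLp.toLp 2 μ + toEuclideanCLM (𝕜 := ℝ) s x))) := by
    intro x
    rw [← ENNReal.ofReal_mul (abs_nonneg _)]
    congr 1
    rw [WithLp.ofLp_add, ofLp_toEuclideanCLM]
    simp only [gaussDensity, add_sub_cancel_left, sub_zero]
    have hq : (s *ᵥ x.ofLp) ⬝ᵥ (S⁻¹ *ᵥ (s *ᵥ x.ofLp)) =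
        x.ofLp ⬝ᵥ ((1 : Matrix (Fin n) (Fin n) ℝ)⁻¹ *ᵥ x.ofLp) := by
      rw [mulVec_mulVec, hsi, Matrix.mul_assoc, nonsing_inv_mul _ hsu, Matrix.mul_one,
        ← vecMul_transpose, hsT, ← dotProduct_mulVec, mulVec_mulVec, mul_nonsing_inv _ hsu, inv_one]
    rw [hq, ← hss, det_mul, det_one, mul_one, Real.sqrt_mul (by positivity),
      Real.sqrt_mul_self_eq_abs, mul_inv]
    have : |s.det| ≠ 0 := abs_ne_zero.2 hsu.ne_zero
    field_simp
  simp only [hpt]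
  have hmeas := (continuous_gaussDensity μ S).measurable.ennreal_ofReal
  have hmc : Measurable fun x : EuclideanSpace ℝ (Fin n) => ENNReal.ofReal (gaussDensity μ S
      (WithLp.ofLp (WithLp.toLp 2 μ + toEuclideanCLM (𝕜 := ℝ) s x))) := hmeas.comp hm
  have hset := setLIntegral_map (μ := volume) hA hmeas hm
  rw [lintegral_const_mul _ hmc, ← hset, hmap,
    Measure.restrict_smul, lintegral_smul_measure, smul_eq_mul, ← mul_assoc,
    ← ENNReal.ofReal_mul (abs_nonneg _), ← abs_mul, mul_inv_cancel₀ hsu.ne_zero]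
  simp

variable {n : ℕ} {μ : Fin n → ℝ} {S : Matrix (Fin n) (Fin n) ℝ}

theorem memLp_eval_sub_multivariateGaussian (i : Fin n) :
    MemLp (fun x : EuclideanSpace ℝ (Fin n) => x i - μ i) 2
      (multivariateGaussian (WithLp.toLp 2 μ) S) := by
  have h : MemLp (fun x : EuclideanSpace ℝ (Fin n) => x i) 2
      (multivariateGaussian (WithLp.toLp 2 μ) S) :=
    (EuclideanSpace.proj (𝕜 := ℝ) i).comp_memLp' IsGaussian.memLp_two_id
  exact h.sub (memLp_const _)

theorem integral_eval_multivariateGaussian (i : Fin n) :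
    ∫ x, x i ∂(multivariateGaussian (WithLp.toLp 2 μ) S) = μ i := by
  have h := (EuclideanSpace.proj (𝕜 := ℝ) i).integral_comp_comm
    (IsGaussian.integrable_id (μ := multivariateGaussian (WithLp.toLp 2 μ) S))
  simpa using h

/-- The expectation of a quadratic function under a multivariate Gaussian. -/
theorem integral_quadratic_multivariateGaussian (hS : S.PosSemidef) (c : ℝ) (v : Fin n → ℝ)
    (K : Matrix (Fin n) (Fin n) ℝ) :
    Integrable (fun x : EuclideanSpace ℝ (Fin n) =>
        c + v ⬝ᵥ (WithLp.ofLp x - μ) + (WithLp.ofLp x - μ) ⬝ᵥ (K *ᵥ (WithLp.ofLp x - μ)))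
        (multivariateGaussian (WithLp.toLp 2 μ) S) ∧
      ∫ x : EuclideanSpace ℝ (Fin n),
        c + v ⬝ᵥ (WithLp.ofLp x - μ) + (WithLp.ofLp x - μ) ⬝ᵥ (K *ᵥ (WithLp.ofLp x - μ))
        ∂(multivariateGaussian (WithLp.toLp 2 μ) S) = c + (K * S).trace := by
  set γ := multivariateGaussian (WithLp.toLp 2 μ) S with hγ
  have h1 : ∀ i, Integrable (fun x : EuclideanSpace ℝ (Fin n) => x i - μ i) γ := fun i =>
    (memLp_eval_sub_multivariateGaussian i).integrable one_le_two
  have h2 : ∀ i j, Integrable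
      (fun x : EuclideanSpace ℝ (Fin n) => (x i - μ i) * (x j - μ j)) γ := fun i j =>
    (memLp_eval_sub_multivariateGaussian i).integrable_mul (memLp_eval_sub_multivariateGaussian j)
  have e1 : ∀ i, ∫ x : EuclideanSpace ℝ (Fin n), x i - μ i ∂γ = 0 := by
    intro i
    have h : Integrable (fun x : EuclideanSpace ℝ (Fin n) => x i) γ := by
      refine ((h1 i).add (integrable_const (μ i))).congr (ae_of_all _ fun x => ?_)
      exact sub_add_cancel (x i) (μ i)
    rw [integral_sub h (integrable_const _), integral_eval_multivariateGaussian]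
    simp
  have e2 : ∀ i j, ∫ x : EuclideanSpace ℝ (Fin n), (x i - μ i) * (x j - μ j) ∂γ = S i j := by
    intro i j
    have h := covariance_eval_multivariateGaussian (μ := WithLp.toLp 2 μ) hS i j
    rw [covariance, integral_eval_multivariateGaussian, integral_eval_multivariateGaussian] at h
    exact h
  have hA : Integrable (fun x : EuclideanSpace ℝ (Fin n) => ∑ i, v i * (x i - μ i)) γ :=
    integrable_finsetSum _ fun i _ => (h1 i).const_mul _
  have hB : ∀ i j, Integrable (fun x : EuclideanSpace ℝ (Fin n) =>
      K i j * ((x i - μ i) * (x j - μ j))) γ := fun i j => (h2 i j).const_mul _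
  have hB' : ∀ i, Integrable (fun x : EuclideanSpace ℝ (Fin n) =>
      ∑ j, K i j * ((x i - μ i) * (x j - μ j))) γ := fun i =>
    integrable_finsetSum _ fun j _ => hB i j
  have hC : Integrable (fun x : EuclideanSpace ℝ (Fin n) =>
      ∑ i, ∑ j, K i j * ((x i - μ i) * (x j - μ j))) γ :=
    integrable_finsetSum _ fun i _ => hB' i
  have hf : (fun x : EuclideanSpace ℝ (Fin n) =>
      c + v ⬝ᵥ (WithLp.ofLp x - μ) + (WithLp.ofLp x - μ) ⬝ᵥ (K *ᵥ (WithLp.ofLp x - μ))) =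
      fun x => c + (∑ i, v i * (x i - μ i)) + ∑ i, ∑ j, K i j * ((x i - μ i) * (x j - μ j)) := by
    funext x
    simp only [dotProduct, mulVec, Pi.sub_apply, Finset.mul_sum]
    congr 1
    exact Finset.sum_congr rfl fun i _ => Finset.sum_congr rfl fun j _ => by ring
  have hcA : Integrable (fun x : EuclideanSpace ℝ (Fin n) =>
      c + ∑ i, v i * (x i - μ i)) γ := (integrable_const c).add hA
  rw [hf]
  refine ⟨hcA.add hC, ?_⟩
  rw [integral_add hcA hC, integral_add (integrable_const c) hA,
    integral_finsetSum _ fun i _ => (h1 i).const_mul _, integral_finsetSum _ fun i _ => hB' i]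
  simp only [integral_const_mul, e1, mul_zero, Finset.sum_const_zero, add_zero]
  have e3 : ∀ i, ∫ x : EuclideanSpace ℝ (Fin n),
      ∑ j, K i j * ((x i - μ i) * (x j - μ j)) ∂γ = ∑ j, K i j * S i j := by
    intro i
    rw [integral_finsetSum _ fun j _ => hB i j]
    simp only [integral_const_mul, e2]
  have hST : Sᵀ = S := hS.1
  simp only [e3]
  rw [trace]
  simp only [diag_apply, mul_apply]
  conv_rhs => rw [← hST]
  simp

/-- Affine images of multivariate Gaussians. -/
theorem map_multivariateGaussian (hS : S.PosSemidef) (b : Fin n → ℝ)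
    (F : Matrix (Fin n) (Fin n) ℝ) :
    (multivariateGaussian (WithLp.toLp 2 μ) S).map
        (fun x => WithLp.toLp 2 (b + F *ᵥ (WithLp.ofLp x - μ))) =
      multivariateGaussian (WithLp.toLp 2 b) (F * S * Fᵀ) := by
  set T := toEuclideanCLM (𝕜 := ℝ) (n := Fin n) F with hT
  have hf : (fun x : EuclideanSpace ℝ (Fin n) => WithLp.toLp 2 (b + F *ᵥ (WithLp.ofLp x - μ))) =
      (fun y => WithLp.toLp 2 (b - F *ᵥ μ) + y) ∘ T := by
    funext x
    apply WithLp.ofLp_injective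
    simp only [Function.comp_apply, WithLp.ofLp_add, hT, ofLp_toEuclideanCLM, mulVec_sub]
    abel
  rw [hf, ← Measure.map_map (measurable_const_add _) (by fun_prop)]
  have hi : Integrable (fun x : EuclideanSpace ℝ (Fin n) => T x)
      (multivariateGaussian (WithLp.toLp 2 μ) S) := T.integrable_comp IsGaussian.integrable_id
  apply IsGaussian.ext
  · rw [integral_id_multivariateGaussian', integral_map (by fun_prop) (by fun_prop),
      integral_map (by fun_prop) (by fun_prop)]
    simp only [id]
    rw [integral_add (integrable_const _) hi, integral_const,
      ContinuousLinearMap.integral_comp_comm _ IsGaussian.integrable_fun_id,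
      integral_id_multivariateGaussian]
    apply WithLp.ofLp_injective
    simp [hT]
  · rw [covarianceBilin_map_const_add]
    ext x y
    rw [covarianceBilin_map IsGaussian.memLp_two_id,
      covarianceBilin_multivariateGaussian hS,
      covarianceBilin_multivariateGaussian (hS.mul_mul_transpose_same F)]
    have hadj : ContinuousLinearMap.adjoint T = toEuclideanCLM (𝕜 := ℝ) (n := Fin n) Fᵀ := by
      rw [← ContinuousLinearMap.star_eq_adjoint, hT, ← map_star, star_eq_conjTranspose,
        conjTranspose_eq_transpose_of_trivial]
    rw [hadj, ofLp_toEuclideanCLM, ofLp_toEuclideanCLM, Matrix.mul_assoc, ← mulVec_mulVec,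
      ← mulVec_mulVec, dotProduct_mulVec _ F, mulVec_transpose]

end ProbabilityTheory

end Gaussian

/-! ### The closed loop as a mixture of Gaussian branches -/

theorem GMMParams.isProbabilityMeasure_law {n q : ℕ} (g : GMMParams n q)
    (hg : g.weight ∈ stdSimplex ℝ (Fin q)) : IsProbabilityMeasure g.law := by
  constructor
  rw [GMMParams.law, Measure.finsetSum_apply]
  simp only [Measure.smul_apply, measure_univ, smul_eq_mul, mul_one]
  rw [← ENNReal.ofReal_sum_of_nonneg fun i _ => hg.1 i, hg.2, ENNReal.ofReal_one]

namespace SteeringData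

variable {n m N r t q : ℕ} {P : SteeringData n m N r t}

namespace Standing

variable (hP : P.Standing)
include hP

theorem mixtureDensity_pos (x : Fin n → ℝ) :
    0 < ∑ i, P.init.weight i * gaussDensity (P.init.mean i) (P.init.cov i) x := by
  have hsum : ∃ i, P.init.weight i ≠ 0 := by
    by_contra! h
    have := hP.init_weight.2
    simp [h] at this
  obtain ⟨i, hi⟩ := hsum
  exact Finset.sum_pos'
    (fun i _ => mul_nonneg (hP.init_weight.1 i) (gaussDensity_nonneg _ _ _))
    ⟨i, Finset.mem_univ i,
      mul_pos (lt_of_le_of_ne (hP.init_weight.1 i) hi.symm) (gaussDensity_pos _ (hP.init_cov i) _)⟩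

theorem posterior_nonneg (i : Fin r) (x : Fin n → ℝ) : 0 ≤ P.posterior i x :=
  div_nonneg (mul_nonneg (hP.init_weight.1 i) (gaussDensity_nonneg _ _ _))
    (hP.mixtureDensity_pos x).le

theorem sum_posterior (x : Fin n → ℝ) : ∑ i, P.posterior i x = 1 := by
  simp only [posterior]
  rw [← Finset.sum_div, div_self (hP.mixtureDensity_pos x).ne']

theorem law_eq_withDensity : P.init.law = volume.withDensity fun x => ENNReal.ofReal
    (∑ i, P.init.weight i * gaussDensity (P.init.mean i) (P.init.cov i) (WithLp.ofLp x)) := by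
  have hm : ∀ i, Measurable fun x : EuclideanSpace ℝ (Fin n) =>
      ENNReal.ofReal (gaussDensity (P.init.mean i) (P.init.cov i) (WithLp.ofLp x)) := fun i =>
    (continuous_gaussDensity _ _).measurable.ennreal_ofReal
  ext A hA
  rw [GMMParams.law, Measure.finsetSum_apply, withDensity_apply _ hA]
  have h1 : ∀ x : EuclideanSpace ℝ (Fin n), ENNReal.ofReal
      (∑ i, P.init.weight i * gaussDensity (P.init.mean i) (P.init.cov i) (WithLp.ofLp x)) =
      ∑ i, ENNReal.ofReal (P.init.weight i) *
        ENNReal.ofReal (gaussDensity (P.init.mean i) (P.init.cov i) (WithLp.ofLp x)) := by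
    intro x
    rw [ENNReal.ofReal_sum_of_nonneg fun i _ =>
      mul_nonneg (hP.init_weight.1 i) (gaussDensity_nonneg _ _ _)]
    exact Finset.sum_congr rfl fun i _ => ENNReal.ofReal_mul (hP.init_weight.1 i)
  simp only [h1]
  rw [lintegral_finsetSum _ fun i _ => (hm i).const_mul _]
  refine Finset.sum_congr rfl fun i _ => ?_
  rw [lintegral_const_mul _ (hm i), Measure.smul_apply, smul_eq_mul,
    multivariateGaussian_eq_withDensity _ (hP.init_cov i), withDensity_apply _ hA]

/-- Bayes' rule: the mixture density is positive everywhere and cancels the denominator of `ℓ_i`,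
leaving `p_i` times the `i`-th Gaussian density. -/
theorem law_withDensity_posterior (i : Fin r) :
    (P.init.law.withDensity fun x => ENNReal.ofReal (P.posterior i (WithLp.ofLp x))) =
      ENNReal.ofReal (P.init.weight i) •
        multivariateGaussian (WithLp.toLp 2 (P.init.mean i)) (P.init.cov i) := by
  have hm : ∀ i, Measurable fun x : EuclideanSpace ℝ (Fin n) =>
      gaussDensity (P.init.mean i) (P.init.cov i) (WithLp.ofLp x) := fun i =>
    (continuous_gaussDensity _ _).measurable
  rw [hP.law_eq_withDensity, multivariateGaussian_eq_withDensity _ (hP.init_cov i),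
    ← withDensity_smul _ (hm i).ennreal_ofReal, ← withDensity_mul _
      (Finset.measurable_sum _ fun i _ => (hm i).const_mul _).ennreal_ofReal
      (P.measurable_posterior i).ennreal_ofReal]
  congr 1
  funext x
  have hpos := hP.mixtureDensity_pos (WithLp.ofLp x)
  rw [Pi.mul_apply, Pi.smul_apply, smul_eq_mul, ← ENNReal.ofReal_mul hpos.le,
    ← ENNReal.ofReal_mul (hP.init_weight.1 i), posterior, mul_div_cancel₀ _ hpos.ne']

theorem isMarkovKernel_ctrlKernel {π : MixPolicy n m N r q} (hπ : π.IsPolicy) :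
    IsMarkovKernel (P.ctrlKernel π) := by
  refine ⟨fun x => ⟨?_⟩⟩
  change (∑ i, ∑ j, ENNReal.ofReal (π.lam i j * P.posterior i (WithLp.ofLp x)) •
    Measure.dirac (P.branch π i j (WithLp.ofLp x)) : Measure _) Set.univ = 1
  simp only [Measure.finsetSum_apply, Measure.smul_apply, measure_univ, smul_eq_mul, mul_one]
  have h : ∀ i, ∑ j, ENNReal.ofReal (π.lam i j * P.posterior i (WithLp.ofLp x)) =
      ENNReal.ofReal (P.posterior i (WithLp.ofLp x)) := by
    intro i
    rw [← ENNReal.ofReal_sum_of_nonneg fun j _ =>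
      mul_nonneg ((hπ i).1 j) (hP.posterior_nonneg i _), ← Finset.sum_mul, (hπ i).2, one_mul]
  simp only [h]
  rw [← ENNReal.ofReal_sum_of_nonneg fun i _ => hP.posterior_nonneg i _, hP.sum_posterior,
    ENNReal.ofReal_one]

theorem isProbabilityMeasure_closedLoop {π : MixPolicy n m N r q} (hπ : π.IsPolicy) :
    IsProbabilityMeasure (P.closedLoop π) := by
  have := hP.isMarkovKernel_ctrlKernel hπ
  have := P.init.isProbabilityMeasure_law hP.init_weight
  unfold closedLoop
  infer_instance

/-- The closed loop is a mixture over the branches of the policy. -/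
theorem closedLoop_eq {π : MixPolicy n m N r q} (hπ : π.IsPolicy) :
    P.closedLoop π = ∑ i, ∑ j, ENNReal.ofReal (P.init.weight i * π.lam i j) •
      (multivariateGaussian (WithLp.toLp 2 (P.init.mean i)) (P.init.cov i)).map
        fun x => (x, P.branch π i j (WithLp.ofLp x)) := by
  have := hP.isMarkovKernel_ctrlKernel hπ
  have := P.init.isProbabilityMeasure_law hP.init_weight
  ext A hA
  rw [closedLoop, Measure.compProd_apply hA]
  have hb : ∀ i j, Measurable fun x : EuclideanSpace ℝ (Fin n) =>
      (x, P.branch π i j (WithLp.ofLp x)) := fun i j =>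
    measurable_id.prodMk (P.measurable_branch π i j)
  have h1 : ∀ x, P.ctrlKernel π x (Prod.mk x ⁻¹' A) = ∑ i, ∑ j,
      ENNReal.ofReal (π.lam i j) * (ENNReal.ofReal (P.posterior i (WithLp.ofLp x)) *
        ((fun x => (x, P.branch π i j (WithLp.ofLp x))) ⁻¹' A).indicator 1 x) := by
    intro x
    change (∑ i, ∑ j, ENNReal.ofReal (π.lam i j * P.posterior i (WithLp.ofLp x)) •
      Measure.dirac (P.branch π i j (WithLp.ofLp x)) : Measure _) (Prod.mk x ⁻¹' A) = _
    simp only [Measure.finsetSum_apply, Measure.smul_apply, smul_eq_mul]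
    refine Finset.sum_congr rfl fun i _ => Finset.sum_congr rfl fun j _ => ?_
    rw [ENNReal.ofReal_mul ((hπ i).1 j), mul_assoc,
      Measure.dirac_apply' _ (measurable_prodMk_left hA)]
    rfl
  have hm : ∀ i j, Measurable fun x : EuclideanSpace ℝ (Fin n) =>
      (((fun x => (x, P.branch π i j (WithLp.ofLp x))) ⁻¹' A).indicator 1 x : ENNReal) :=
    fun i j => measurable_one.indicator (hb i j hA)
  have hm2 : ∀ i j, Measurable fun x : EuclideanSpace ℝ (Fin n) =>
      ENNReal.ofReal (P.posterior i (WithLp.ofLp x)) *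
        ((fun x => (x, P.branch π i j (WithLp.ofLp x))) ⁻¹' A).indicator 1 x :=
    fun i j => (P.measurable_posterior i).ennreal_ofReal.mul (hm i j)
  simp only [h1]
  rw [lintegral_finsetSum _ fun i _ => Finset.measurable_sum _ fun j _ => (hm2 i j).const_mul _]
  simp only [Measure.finsetSum_apply, Measure.smul_apply, smul_eq_mul]
  refine Finset.sum_congr rfl fun i _ => ?_
  rw [lintegral_finsetSum _ fun j _ => (hm2 i j).const_mul _]
  refine Finset.sum_congr rfl fun j _ => ?_
  rw [lintegral_const_mul _ (hm2 i j), Measure.map_apply (hb i j) hA]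
  -- The posterior weight is absorbed into the initial law, which Bayes' rule then replaces by the
  -- `i`-th weighted Gaussian.
  have h2 := lintegral_withDensity_eq_lintegral_mul P.init.law
    (P.measurable_posterior i).ennreal_ofReal (hm i j)
  simp only [Pi.mul_apply] at h2
  rw [← h2, hP.law_withDensity_posterior, lintegral_smul_measure,
    lintegral_indicator_one (hb i j hA), smul_eq_mul, ← mul_assoc,
    ← ENNReal.ofReal_mul ((hπ i).1 j), mul_comm (π.lam i j)]

/-- Expansion of the branch cost about the component mean. Under the Gaussian the linear term
integrates to zero, and the quadratic term contributes the trace that is `Jcov`. -/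
theorem Jmean_branch (μ x : Fin n → ℝ) (L : Matrix (Fin m × Fin N) (Fin n) ℝ)
    (U : Fin m × Fin N → ℝ) :
    P.Jmean x (L *ᵥ (x - μ) + U) = P.Jmean μ U +
      (2 : ℝ) • (Lᵀ *ᵥ (P.Rb *ᵥ U) + (P.Γ + P.Hu * L)ᵀ *ᵥ
        (P.Qb *ᵥ (P.Γ *ᵥ μ + P.Hu *ᵥ U - P.Xref))) ⬝ᵥ (x - μ) +
      (x - μ) ⬝ᵥ ((Lᵀ * P.Rb * L + (P.Γ + P.Hu * L)ᵀ * P.Qb * (P.Γ + P.Hu * L)) *ᵥ (x - μ)) := by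
  obtain ⟨y, rfl⟩ : ∃ y, x = y + μ := ⟨x - μ, by abel⟩
  rw [add_sub_cancel_right]
  have h1 : P.Γ *ᵥ (y + μ) + P.Hu *ᵥ (L *ᵥ y + U) - P.Xref =
      (P.Γ *ᵥ μ + P.Hu *ᵥ U - P.Xref) + (P.Γ + P.Hu * L) *ᵥ y := by
    rw [mulVec_add, mulVec_add, add_mulVec, mulVec_mulVec]
    abel
  have h2 : ∀ {ι : Type} [Fintype ι] (F : Matrix ι (Fin n) ℝ) (w : ι → ℝ),
      (F *ᵥ y) ⬝ᵥ w = y ⬝ᵥ (Fᵀ *ᵥ w) := by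
    intro ι _ F w
    rw [dotProduct_mulVec y, vecMul_transpose]
  rw [Jmean, Jmean, h1, add_comm (L *ᵥ y), IsSymm.dotProduct_mulVec_add hP.Rb_transpose,
    IsSymm.dotProduct_mulVec_add hP.Qb_transpose, smul_dotProduct, dotProduct_comm (_ + _) y]
  generalize P.Γ + P.Hu * L = G
  simp only [h2, mulVec_mulVec, dotProduct_add, add_mulVec, smul_eq_mul, Matrix.mul_assoc]
  ring

theorem integral_Jmean_branch (π : MixPolicy n m N r q) (i : Fin r) (j : Fin q) :
    Integrable (fun x : EuclideanSpace ℝ (Fin n) =>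
        P.Jmean (WithLp.ofLp x) (P.branch π i j (WithLp.ofLp x)))
        (multivariateGaussian (WithLp.toLp 2 (P.init.mean i)) (P.init.cov i)) ∧
      ∫ x : EuclideanSpace ℝ (Fin n), P.Jmean (WithLp.ofLp x) (P.branch π i j (WithLp.ofLp x))
        ∂(multivariateGaussian (WithLp.toLp 2 (P.init.mean i)) (P.init.cov i)) =
        P.Jmean (P.init.mean i) (π.ff i j) + P.Jcov (P.init.cov i) (π.gain i j) := by
  simp only [branch, hP.Jmean_branch]
  convert! integral_quadratic_multivariateGaussian (μ := P.init.mean i)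
    (hP.init_cov i).posSemidef _ _ _ using 3
  rw [Jcov, Matrix.add_mul, trace_add]
  congr 1
  · rw [trace_mul_comm]
    simp only [Matrix.mul_assoc]
  · rw [trace_mul_comm]
    simp only [Matrix.mul_assoc]

theorem integrable_cost_and_expCost_eq {π : MixPolicy n m N r q} (hπ : π.IsPolicy) :
    Integrable (fun x => P.cost (WithLp.ofLp x.1) x.2) (P.closedLoop π) ∧
    P.expCost π = ∑ i, ∑ j, P.init.weight i * π.lam i j *
      (P.Jmean (P.init.mean i) (π.ff i j) + P.Jcov (P.init.cov i) (π.gain i j)) := by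
  have hc : Continuous fun x : EuclideanSpace ℝ (Fin n) × (Fin m × Fin N → ℝ) =>
      P.cost (WithLp.ofLp x.1) x.2 := by
    simp only [cost_eq_Jmean]
    unfold Jmean
    simp only [dotProduct, mulVec, Pi.sub_apply, Pi.add_apply]
    fun_prop
  have hb : ∀ i j, Measurable fun x : EuclideanSpace ℝ (Fin n) =>
      (x, P.branch π i j (WithLp.ofLp x)) := fun i j =>
    measurable_id.prodMk (P.measurable_branch π i j)
  have hint : ∀ i j, Integrable (fun x => P.cost (WithLp.ofLp x.1) x.2)
      (ENNReal.ofReal (P.init.weight i * π.lam i j) •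
      (multivariateGaussian (WithLp.toLp 2 (P.init.mean i)) (P.init.cov i)).map
        fun x => (x, P.branch π i j (WithLp.ofLp x))) := by
    intro i j
    refine Integrable.smul_measure ?_ ENNReal.ofReal_ne_top
    rw [integrable_map_measure hc.aestronglyMeasurable (hb i j).aemeasurable]
    simp only [Function.comp_def, cost_eq_Jmean]
    exact (hP.integral_Jmean_branch π i j).1
  have hint' : ∀ i, Integrable (fun x => P.cost (WithLp.ofLp x.1) x.2)
      (∑ j, ENNReal.ofReal (P.init.weight i * π.lam i j) •
      (multivariateGaussian (WithLp.toLp 2 (P.init.mean i)) (P.init.cov i)).map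
        fun x => (x, P.branch π i j (WithLp.ofLp x))) := fun i =>
    integrable_finsetSum_measure.2 fun j _ => hint i j
  rw [expCost, hP.closedLoop_eq hπ]
  refine ⟨integrable_finsetSum_measure.2 fun i _ => hint' i, ?_⟩
  rw [integral_finsetSum_measure fun i _ => hint' i]
  refine Finset.sum_congr rfl fun i _ => ?_
  rw [integral_finsetSum_measure fun j _ => hint i j]
  refine Finset.sum_congr rfl fun j _ => ?_
  rw [integral_smul_measure, integral_map (hb i j).aemeasurable hc.aestronglyMeasurable,
    ENNReal.toReal_ofReal (mul_nonneg (hP.init_weight.1 i) ((hπ i).1 j)), smul_eq_mul]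
  simp only [cost_eq_Jmean]
  rw [(hP.integral_Jmean_branch π i j).2]

/-- In branch `(i, j)` the terminal state is an affine function of the `i`-th Gaussian, with image
the Gaussian `j` whatever `i` is. Summing `p_i λ_ij` over `i` collects the weight of component `j`.
-/
theorem terminalLaw_eq {π : MixPolicy n m N r q} {g : GMMParams n q} (hπ : π.IsPolicy)
    (hg : P.IsTerminalGMM π g) : P.terminalLaw π = g.law := by
  have hb : ∀ i j, Measurable fun x : EuclideanSpace ℝ (Fin n) =>
      (x, P.branch π i j (WithLp.ofLp x)) := fun i j =>
    measurable_id.prodMk (P.measurable_branch π i j)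
  have ht : Measurable fun z : EuclideanSpace ℝ (Fin n) × (Fin m × Fin N → ℝ) =>
      WithLp.toLp 2 (P.traj (WithLp.ofLp z.1) z.2 N) := by
    apply Continuous.measurable
    simp only [traj_terminal]
    refine (PiLp.continuous_toLp 2 _).comp ?_
    refine continuous_pi fun a => ?_
    simp only [dotProduct, mulVec, Pi.add_apply]
    fun_prop
  have hmap : ∀ i j, Measure.map (fun z : EuclideanSpace ℝ (Fin n) × (Fin m × Fin N → ℝ) =>
      WithLp.toLp 2 (P.traj (WithLp.ofLp z.1) z.2 N))
      ((multivariateGaussian (WithLp.toLp 2 (P.init.mean i)) (P.init.cov i)).map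
        fun x => (x, P.branch π i j (WithLp.ofLp x))) =
      multivariateGaussian (WithLp.toLp 2 (g.mean j)) (g.cov j) := by
    intro i j
    rw [Measure.map_map ht (hb i j), hg.cov_eq i j, hg.mean_eq i j,
      ← map_multivariateGaussian (hP.init_cov i).posSemidef]
    congr 1
    funext x
    simp only [Function.comp_apply, traj_terminal, branch]
    congr 1
    simp only [mulVec_add, mulVec_sub, add_mulVec, mulVec_mulVec]
    abel
  rw [terminalLaw, hP.closedLoop_eq hπ, ← Measure.mapₗ_apply_of_measurable ht]
  simp only [map_sum, map_smul]
  simp only [Measure.mapₗ_apply_of_measurable ht, hmap]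
  rw [Finset.sum_comm, GMMParams.law]
  refine Finset.sum_congr rfl fun j _ => ?_
  rw [← Finset.sum_smul, hg.weight_eq, ENNReal.ofReal_sum_of_nonneg fun i _ =>
    mul_nonneg (hP.init_weight.1 i) ((hπ i).1 j)]

end Standing

end SteeringData

/-! ### Couplings -/

theorem couplings_row_sum {a b : ℕ} {p : Fin a → ℝ} {p' : Fin b → ℝ}
    {X : Matrix (Fin a) (Fin b) ℝ} (hX : X ∈ couplings p p') (i : Fin a) : ∑ j, X i j = p i := by
  have := congrFun hX.1 i
  simpa [mulVec, dotProduct] using this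

theorem couplings_col_sum {a b : ℕ} {p : Fin a → ℝ} {p' : Fin b → ℝ}
    {X : Matrix (Fin a) (Fin b) ℝ} (hX : X ∈ couplings p p') (j : Fin b) : ∑ i, X i j = p' j := by
  have := congrFun hX.2.1 j
  simpa [mulVec, dotProduct] using this

theorem mem_couplings_of_sums {a b : ℕ} {p : Fin a → ℝ} {p' : Fin b → ℝ}
    {X : Matrix (Fin a) (Fin b) ℝ} (h1 : ∀ i, ∑ j, X i j = p i) (h2 : ∀ j, ∑ i, X i j = p' j)
    (h3 : ∀ i j, 0 ≤ X i j) : X ∈ couplings p p' :=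
  ⟨funext fun i => by simpa [mulVec, dotProduct] using h1 i,
    funext fun j => by simpa [mulVec, dotProduct] using h2 j, h3⟩

theorem couplings_nonempty {a b : ℕ} {p : Fin a → ℝ} {p' : Fin b → ℝ}
    (hp : p ∈ stdSimplex ℝ (Fin a)) (hp' : p' ∈ stdSimplex ℝ (Fin b)) :
    (couplings p p').Nonempty := by
  refine ⟨of fun i j => p i * p' j, mem_couplings_of_sums (fun i => ?_) (fun j => ?_)
    fun i j => mul_nonneg (hp.1 i) (hp'.1 j)⟩
  · simp only [of_apply]
    rw [← Finset.mul_sum, hp'.2, mul_one]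
  · simp only [of_apply]
    rw [← Finset.sum_mul, hp.2, one_mul]

theorem isCompact_couplings {a b : ℕ} (p : Fin a → ℝ) (p' : Fin b → ℝ) :
    IsCompact (couplings p p') := by
  have hK : IsCompact (Set.pi Set.univ fun i : Fin a => Set.pi Set.univ fun _ : Fin b =>
      Set.Icc (0 : ℝ) (p i)) :=
    isCompact_univ_pi fun i => isCompact_univ_pi fun _ => isCompact_Icc
  refine IsCompact.of_isClosed_subset hK ?_ fun X hX i _ j _ => ⟨hX.2.2 i j, ?_⟩
  · have h1 : IsClosed {X : Matrix (Fin a) (Fin b) ℝ | X *ᵥ 1 = p} :=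
      isClosed_eq (Continuous.matrix_mulVec continuous_id continuous_const) continuous_const
    have h2 : IsClosed {X : Matrix (Fin a) (Fin b) ℝ | Xᵀ *ᵥ 1 = p'} :=
      isClosed_eq (Continuous.matrix_mulVec continuous_id.matrix_transpose continuous_const)
        continuous_const
    have h3 : IsClosed {X : Matrix (Fin a) (Fin b) ℝ | ∀ i j, 0 ≤ X i j} := by
      simp only [Set.ofPred_forall]
      exact isClosed_iInter fun i => isClosed_iInter fun j =>
        isClosed_le continuous_const (continuous_id.matrix_elem i j)
    exact h1.inter (h2.inter h3)
  · rw [← couplings_row_sum hX i]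
    exact Finset.single_le_sum (f := fun j => X i j) (fun j _ => hX.2.2 i j) (Finset.mem_univ j)

/-- The squared GMM-Wasserstein distance is the optimal value of the discrete transport problem,
and this value is attained. -/
theorem gmmW_sq_isLeast {n a b : ℕ} {g : GMMParams n a} {g' : GMMParams n b}
    (hg : g.weight ∈ stdSimplex ℝ (Fin a)) (hg' : g'.weight ∈ stdSimplex ℝ (Fin b))
    (hc : ∀ i, (g.cov i).PosSemidef) (hc' : ∀ j, (g'.cov j).PosDef) :
    IsLeast ((fun X : Matrix (Fin a) (Fin b) ℝ =>
      ∑ i, ∑ j, gaussW2Sq (g.mean i) (g.cov i) (g'.mean j) (g'.cov j) * X i j) ''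
      couplings g.weight g'.weight) (gmmW g g' ^ 2) := by
  obtain ⟨X, hX, hmin⟩ := (isCompact_couplings g.weight g'.weight).exists_isMinOn
    (couplings_nonempty hg hg') (f := fun X : Matrix (Fin a) (Fin b) ℝ =>
      ∑ i, ∑ j, gaussW2Sq (g.mean i) (g.cov i) (g'.mean j) (g'.cov j) * X i j) (by
    refine Continuous.continuousOn ?_
    exact continuous_finsetSum _ fun i _ => continuous_finsetSum _ fun j _ =>
      continuous_const.mul (continuous_id.matrix_elem i j))
  have hl : IsLeast ((fun X : Matrix (Fin a) (Fin b) ℝ =>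
      ∑ i, ∑ j, gaussW2Sq (g.mean i) (g.cov i) (g'.mean j) (g'.cov j) * X i j) ''
      couplings g.weight g'.weight)
      (∑ i, ∑ j, gaussW2Sq (g.mean i) (g.cov i) (g'.mean j) (g'.cov j) * X i j) :=
    ⟨⟨X, hX, rfl⟩, by rintro _ ⟨Y, hY, rfl⟩; exact hmin hY⟩
  -- Squaring undoes the root only because the optimal transport value is nonnegative.
  rw [gmmW, Real.sq_sqrt]
  · rw [hl.csInf_eq]
    exact hl
  · rw [hl.csInf_eq]
    exact Finset.sum_nonneg fun i _ => Finset.sum_nonneg fun j _ =>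
      mul_nonneg (gaussW2Sq_nonneg _ _ (hc i) (hc' j)) (hX.2.2 i j)

/-! ### Comparison of policies with points of the bilinear program -/

namespace SteeringData

variable {n m N r t q : ℕ} {P : SteeringData n m N r t}

theorem bilinCost_eq (s : BilinVars n r q t) : P.bilinCost s =
    ∑ i, ∑ j, s.C i j * s.lamT i j + P.κ * ∑ i, ∑ j, s.T i j * s.β i j := by
  rw [bilinCost, trace, trace]
  simp only [diag_apply, mul_apply, transpose_apply]
  rw [Finset.sum_comm, Finset.sum_comm (γ := Fin q)]

namespace Standing

variable (hP : P.Standing)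
include hP

theorem terminal_weight_mem {π : MixPolicy n m N r q} {g : GMMParams n q} (hπ : π.IsPolicy)
    (hg : P.IsTerminalGMM π g) : g.weight ∈ stdSimplex ℝ (Fin q) := by
  refine ⟨fun j => ?_, ?_⟩
  · rw [hg.weight_eq]
    exact Finset.sum_nonneg fun i _ => mul_nonneg (hP.init_weight.1 i) ((hπ i).1 j)
  · simp only [hg.weight_eq]
    rw [Finset.sum_comm, ← hP.init_weight.2]
    refine Finset.sum_congr rfl fun i _ => ?_
    rw [← Finset.mul_sum, (hπ i).2, mul_one]

theorem policyCost_eq {π : MixPolicy n m N r q} {g : GMMParams n q} (hπ : π.IsPolicy) :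
    P.policyCost (π, g) = ∑ i, ∑ j, (P.Jmean (P.init.mean i) (π.ff i j) +
      P.Jcov (P.init.cov i) (π.gain i j)) * (P.init.weight i * π.lam i j) +
      P.κ * gmmW g P.des ^ 2 := by
  rw [policyCost, (hP.integrable_cost_and_expCost_eq hπ).2]
  simp only [mul_comm]

theorem policyCost_nonneg {π : MixPolicy n m N r q} {g : GMMParams n q} (hπ : π.IsPolicy) :
    0 ≤ P.policyCost (π, g) := by
  rw [hP.policyCost_eq hπ]
  have := hP.kappa_pos
  exact add_nonneg (Finset.sum_nonneg fun i _ => Finset.sum_nonneg fun j _ =>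
    mul_nonneg (add_nonneg (hP.Jmean_nonneg _ _) (hP.Jcov_nonneg (hP.init_cov i).posSemidef _))
      (mul_nonneg (hP.init_weight.1 i) ((hπ i).1 j))) (by positivity)

/-- The least value of `2 tr L` under the matrix inequality is the varying term in the closed form
of the covariance steering cost. -/
theorem steering_le_boundC {D : Matrix (Fin m × Fin N) (Fin (m * N - n)) ℝ}
    (hD : D.rank = m * N - n) (hBD : P.BN * D = 0) {s : BilinVars n r q t} {i : Fin r} {j : Fin q}
    (hS : (s.SN j).PosSemidef)
    (hL : (fromBlocks (P.Θ₈ D * s.SN j * (P.Θ₈ D)ᵀ) (s.L i j)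
      (s.L i j)ᵀ (P.init.cov i)).PosSemidef) :
    P.JmeanStar (P.init.mean i) (s.μN j) + P.JcovStar (P.init.cov i) (s.SN j) ≤
      P.boundC D s i j := by
  obtain ⟨F, -, hF, hv, htr⟩ := hP.exists_solvesCov hD hBD (hP.init_cov i) hS
  have h := neg_trace_cfcSqrt_le_trace (hP.init_cov i) hL
  rw [boundC, ← SolvesCov_Jcov_eq hF, hv, htr, trace_add, trace_transpose]
  linarith

theorem gaussW2Sq_le_boundT {s : BilinVars n r q t} {i : Fin q} {j : Fin t}
    (hY : (fromBlocks (s.SN i) (s.Y i j) (s.Y i j)ᵀ (P.des.cov j)).PosSemidef) :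
    gaussW2Sq (s.μN i) (s.SN i) (P.des.mean j) (P.des.cov j) ≤ P.boundT s i j := by
  have h := neg_trace_cfcSqrt_le_trace (hP.des_cov j) hY
  rw [gaussW2Sq, boundT, trace_add, trace_add, trace_transpose, ← neg_sub (P.des.mean j),
    neg_dotProduct_neg]
  linarith

/-- Prescribed weights, couplings and terminal mixture extend to a feasible point of the program
at which all the epigraph constraints are tight. -/
theorem exists_tight_point {D : Matrix (Fin m × Fin N) (Fin (m * N - n)) ℝ}
    (hD : D.rank = m * N - n) (hBD : P.BN * D = 0) {𝒮 : Set (Matrix (Fin n) (Fin n) ℝ)}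
    (hpsd : ∀ S ∈ 𝒮, S.PosSemidef) {g : GMMParams n q} (hw : g.weight ∈ stdSimplex ℝ (Fin q))
    (hc : ∀ j, g.cov j ∈ 𝒮) {lamT : Matrix (Fin r) (Fin q) ℝ} {β : Matrix (Fin q) (Fin t) ℝ}
    (hlam : lamT ∈ couplings P.init.weight g.weight)
    (hβ : β ∈ couplings g.weight P.des.weight) :
    ∃ s ∈ P.bilinFeasible D q 𝒮, s.lamT = lamT ∧ s.β = β ∧ s.gmm = g ∧ P.IsTight D s := by
  choose F hF hFs hFv hFt using fun i j =>
    hP.exists_solvesCov hD hBD (hP.init_cov i) (hpsd _ (hc j))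
  -- The case `Θ = 1` of the matrix problem. `Y = G * Σ^d` then attains the least trace.
  choose G hG hGt using fun i j =>
    exists_congruence_trace_eq (hP.des_cov j) (hpsd _ (hc i)) 1
  let s : BilinVars n r q t :=
    { lamT := lamT
      C := of fun i j => P.JmeanStar (P.init.mean i) (g.mean j) +
        P.JcovStar (P.init.cov i) (g.cov j)
      β := β
      T := of fun i j => gaussW2Sq (g.mean i) (g.cov i) (P.des.mean j) (P.des.cov j)
      pN := g.weight
      L := fun i j => P.Θ₈ D * F i j * P.init.cov i
      Y := fun i j => G i j * P.des.cov j
      μN := g.mean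
      SN := g.cov }
  have hC : ∀ i j, s.C i j = P.boundC D s i j := by
    intro i j
    change P.JmeanStar (P.init.mean i) (g.mean j) + P.JcovStar (P.init.cov i) (g.cov j) =
      P.JmeanStar (P.init.mean i) (g.mean j) + (P.Θ₆ D * g.cov j).trace +
      (P.Θ₇ D * P.init.cov i).trace + (P.Θ₈ D * F i j * P.init.cov i +
        (P.Θ₈ D * F i j * P.init.cov i)ᵀ).trace
    rw [← SolvesCov_Jcov_eq (hFs i j), hFv, trace_add, trace_transpose]
    ring
  have hT : ∀ i j, s.T i j = P.boundT s i j := by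
    intro i j
    change gaussW2Sq (g.mean i) (g.cov i) (P.des.mean j) (P.des.cov j) =
      (P.des.mean j - g.mean i) ⬝ᵥ (P.des.mean j - g.mean i) + (g.cov i).trace +
      (P.des.cov j).trace + (G i j * P.des.cov j + (G i j * P.des.cov j)ᵀ).trace
    have h := hGt i j
    simp only [Matrix.one_mul, transpose_one, Matrix.mul_one] at h
    rw [gaussW2Sq, trace_add, trace_add, trace_transpose, ← neg_sub (P.des.mean j),
      neg_dotProduct_neg, h]
    ring
  refine ⟨s, ⟨hw, hc, hlam, hβ, fun i j => (hC i j).ge, fun i j => ?_, fun i j => (hT i j).ge,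
    fun i j => ?_⟩, rfl, rfl, rfl, ⟨hC, fun _ _ => rfl, hT, fun _ _ => rfl⟩⟩
  · have h := (hP.init_cov i).posSemidef.fromBlocks_of_mul (P.Θ₈ D * F i j)
    have h2 : P.Θ₈ D * F i j * P.init.cov i * (P.Θ₈ D * F i j)ᵀ =
        P.Θ₈ D * g.cov j * (P.Θ₈ D)ᵀ := by
      rw [← hF i j, transpose_mul]
      simp only [Matrix.mul_assoc]
    rw [h2] at h
    exact h
  · have h := (hP.des_cov j).posSemidef.fromBlocks_of_mul (G i j)
    rw [hG i j] at h
    exact h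

/-- Every feasible policy is dominated by a feasible point of the program. -/
theorem exists_bilin_le_policyCost {D : Matrix (Fin m × Fin N) (Fin (m * N - n)) ℝ}
    (hD : D.rank = m * N - n) (hBD : P.BN * D = 0) {𝒮 : Set (Matrix (Fin n) (Fin n) ℝ)}
    (hpsd : ∀ S ∈ 𝒮, S.PosSemidef) {z : MixPolicy n m N r q × GMMParams n q}
    (hz : z ∈ P.policyFeasible q 𝒮) :
    ∃ s ∈ P.bilinFeasible D q 𝒮, (∀ i j, s.lamT i j = P.init.weight i * z.1.lam i j) ∧
      s.gmm = z.2 ∧ P.bilinCost s ≤ P.policyCost z := by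
  obtain ⟨π, g⟩ := z
  obtain ⟨hπ, hg, hc⟩ := hz
  have hw := hP.terminal_weight_mem hπ hg
  have hgmm := gmmW_sq_isLeast hw hP.des_weight (fun i => hpsd _ (hc i)) hP.des_cov
  obtain ⟨β, hβ, hβv⟩ := hgmm.1
  obtain ⟨s, hs, hsl, hsβ, hsg, hst⟩ := hP.exists_tight_point hD hBD hpsd hw hc
    (lamT := of fun i j => P.init.weight i * π.lam i j) (mem_couplings_of_sums
      (fun i => by
        simp only [of_apply]
        rw [← Finset.mul_sum, (hπ i).2, mul_one])
      (fun j => (hg.weight_eq j).symm)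
      fun i j => mul_nonneg (hP.init_weight.1 i) ((hπ i).1 j)) hβ
  have hμ : s.μN = g.mean := congrArg GMMParams.mean hsg
  have hS : s.SN = g.cov := congrArg GMMParams.cov hsg
  refine ⟨s, hs, fun i j => by rw [hsl]; rfl, hsg, ?_⟩
  rw [bilinCost_eq, hP.policyCost_eq hπ, ← hβv, hsl, hsβ]
  simp only [hst.C_value, hst.T_value, hμ, hS]
  refine add_le_add_left (Finset.sum_le_sum fun i _ => Finset.sum_le_sum fun j _ =>
    mul_le_mul_of_nonneg_right (add_le_add (hP.JmeanStar_le (hg.mean_eq i j)) ?_)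
      (mul_nonneg (hP.init_weight.1 i) ((hπ i).1 j))) _
  obtain ⟨F, -, hF, -, -⟩ := hP.exists_solvesCov hD hBD (hP.init_cov i) (hpsd _ (hc j))
  rw [← SolvesCov_Jcov_eq hF]
  exact hF.2 (hg.cov_eq i j)

theorem exists_isExtracted (hq : 0 < q) {D : Matrix (Fin m × Fin N) (Fin (m * N - n)) ℝ}
    (hD : D.rank = m * N - n) (hBD : P.BN * D = 0) {𝒮 : Set (Matrix (Fin n) (Fin n) ℝ)}
    (hpsd : ∀ S ∈ 𝒮, S.PosSemidef) {s : BilinVars n r q t} (hs : s ∈ P.bilinFeasible D q 𝒮) :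
    ∃ π : MixPolicy n m N r q, P.IsExtracted s π := by
  choose F hF hFs hFv hFt using fun i j =>
    hP.exists_solvesCov hD hBD (hP.init_cov i) (hpsd _ (hs.cov_mem j))
  -- A row with `p_i = 0` is filled with the unit mass at index `0`, which exists because `0 < q`.
  refine ⟨⟨of fun i j => if P.init.weight i = 0 then
      (Pi.single ⟨0, hq⟩ 1 : Fin q → ℝ) j else
      s.lamT i j / P.init.weight i, fun i j => P.gainOf D (F i j),
      fun i j => P.Ustar (P.init.mean i) (s.μN j)⟩, fun i hi => ?_, fun i j hi => ?_,
      fun i j => hP.solvesMean_Ustar _ _, fun i j => hFs i j⟩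
  · convert! single_mem_stdSimplex ℝ (⟨0, hq⟩ : Fin q) using 1
    funext j
    simp [hi]
  · simp [hi]

omit hP in
-- When `p_i = 0`, row `i` of `lamT` is nonnegative with sum zero, hence zero, so the identity holds
-- for any choice of `λ_ij`.
theorem weight_mul_lam_of_isExtracted {s : BilinVars n r q t}
    (hs : s.lamT ∈ couplings P.init.weight s.pN) {π : MixPolicy n m N r q}
    (hπ : P.IsExtracted s π) (i : Fin r) (j : Fin q) :
    P.init.weight i * π.lam i j = s.lamT i j := by
  by_cases hi : P.init.weight i = 0
  · have h := couplings_row_sum hs i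
    rw [hi, Finset.sum_eq_zero_iff_of_nonneg fun j _ => hs.2.2 i j] at h
    rw [hi, zero_mul, h j (Finset.mem_univ j)]
  · rw [hπ.lam_eq i j hi, mul_div_cancel₀ _ hi]

/-- The comparison is termwise. Each optimal steering cost is at most `boundC`, hence at most `C`.
The optimal transport value is at most that of the coupling `β`, whose ground costs are at most
`boundT`, hence at most `T`. All weights are nonnegative. -/
theorem isExtracted_feasible_and_le {D : Matrix (Fin m × Fin N) (Fin (m * N - n)) ℝ}
    (hD : D.rank = m * N - n) (hBD : P.BN * D = 0) {𝒮 : Set (Matrix (Fin n) (Fin n) ℝ)}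
    (hpsd : ∀ S ∈ 𝒮, S.PosSemidef) {s : BilinVars n r q t} (hs : s ∈ P.bilinFeasible D q 𝒮)
    {π : MixPolicy n m N r q} (hπ : P.IsExtracted s π) :
    (π, s.gmm) ∈ P.policyFeasible q 𝒮 ∧ P.policyCost (π, s.gmm) ≤ P.bilinCost s := by
  have hlam := weight_mul_lam_of_isExtracted hs.lam_coupling hπ
  have hpol : π.IsPolicy := by
    intro i
    by_cases hi : P.init.weight i = 0
    · exact hπ.isPolicy i hi
    · refine ⟨fun j => ?_, ?_⟩
      · rw [hπ.lam_eq i j hi]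
        exact div_nonneg (hs.lam_coupling.2.2 i j) (hP.init_weight.1 i)
      · simp only [hπ.lam_eq i _ hi]
        rw [← Finset.sum_div, couplings_row_sum hs.lam_coupling, div_self hi]
  refine ⟨⟨hpol, ⟨fun j => ?_, fun i j => (hπ.ff_opt i j).1, fun i j => (hπ.gain_opt i j).1⟩,
    hs.cov_mem⟩, ?_⟩
  · simp only [hlam]
    exact (couplings_col_sum hs.lam_coupling j).symm
  · have hgmm := gmmW_sq_isLeast (g := s.gmm) (g' := P.des) hs.weights hP.des_weight
      (fun i => hpsd _ (hs.cov_mem i)) hP.des_cov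
    rw [hP.policyCost_eq hpol, bilinCost_eq]
    refine add_le_add (Finset.sum_le_sum fun i _ => Finset.sum_le_sum fun j _ => ?_)
      (mul_le_mul_of_nonneg_left ((hgmm.2 ⟨s.β, hs.beta_coupling, rfl⟩).trans
        (Finset.sum_le_sum fun i _ => Finset.sum_le_sum fun j _ => ?_)) hP.kappa_pos.le)
    · rw [hlam, hP.Jmean_eq_JmeanStar (hπ.ff_opt i j), SolvesCov_Jcov_eq (hπ.gain_opt i j)]
      exact mul_le_mul_of_nonneg_right ((hP.steering_le_boundC hD hBD (hpsd _ (hs.cov_mem j))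
        (hs.C_lmi i j)).trans (hs.C_bound i j)) (hs.lam_coupling.2.2 i j)
    · exact mul_le_mul_of_nonneg_right
        ((hP.gaussW2Sq_le_boundT (hs.T_lmi i j)).trans (hs.T_bound i j))
        (hs.beta_coupling.2.2 i j)

theorem bilinFeasible_nonempty (hq : 0 < q) {D : Matrix (Fin m × Fin N) (Fin (m * N - n)) ℝ}
    (hD : D.rank = m * N - n) (hBD : P.BN * D = 0) {𝒮 : Set (Matrix (Fin n) (Fin n) ℝ)}
    (hpsd : ∀ S ∈ 𝒮, S.PosSemidef) (hone : 1 ∈ 𝒮) :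
    (P.bilinFeasible D q 𝒮).Nonempty := by
  have hw := single_mem_stdSimplex ℝ (⟨0, hq⟩ : Fin q)
  obtain ⟨lamT, hlam⟩ := couplings_nonempty hP.init_weight hw
  obtain ⟨β, hβ⟩ := couplings_nonempty hw hP.des_weight
  -- The terminal mixture may be arbitrary: all mass sits on one component, with zero means and
  -- identity covariances.
  obtain ⟨s, hs, -⟩ := hP.exists_tight_point hD hBD hpsd
    (g := ⟨Pi.single (⟨0, hq⟩ : Fin q) 1, 0, 1⟩) hw (fun _ => hone) hlam hβ
  exact ⟨s, hs⟩

/-- At an optimal point the epigraph constraints are tight on the support of the couplings. -/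
theorem tight_of_isMinOn {D : Matrix (Fin m × Fin N) (Fin (m * N - n)) ℝ}
    (hD : D.rank = m * N - n) (hBD : P.BN * D = 0) {𝒮 : Set (Matrix (Fin n) (Fin n) ℝ)}
    (hpsd : ∀ S ∈ 𝒮, S.PosSemidef) {s : BilinVars n r q t} (hs : s ∈ P.bilinFeasible D q 𝒮)
    (hmin : IsMinOn P.bilinCost (P.bilinFeasible D q 𝒮) s) :
    (∀ i j, 0 < s.lamT i j → s.C i j = P.boundC D s i j ∧
        s.C i j = P.JmeanStar (P.init.mean i) (s.μN j) + P.JcovStar (P.init.cov i) (s.SN j)) ∧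
      (∀ i j, 0 < s.β i j → s.T i j = P.boundT s i j ∧
        s.T i j = gaussW2Sq (s.μN i) (s.SN i) (P.des.mean j) (P.des.cov j)) ∧
      ∃ s' ∈ P.bilinFeasible D q 𝒮, IsMinOn P.bilinCost (P.bilinFeasible D q 𝒮) s' ∧
        s'.lamT = s.lamT ∧ s'.β = s.β ∧ s'.gmm = s.gmm ∧ P.IsTight D s' := by
  -- The optimal point is compared with the tight point that has the same weights, couplings and
  -- terminal mixture. Its entries of `C` and `T` are no larger, so optimality of `s` makes the two
  -- costs equal.
  obtain ⟨s', hs', hl, hβ, hg, ht⟩ := hP.exists_tight_point hD hBD hpsd (g := s.gmm) hs.weights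
    hs.cov_mem hs.lam_coupling hs.beta_coupling
  have hμ : s'.μN = s.μN := congrArg GMMParams.mean hg
  have hS : s'.SN = s.SN := congrArg GMMParams.cov hg
  have hC : ∀ i j, s'.C i j ≤ P.boundC D s i j := fun i j => by
    rw [ht.C_value, hμ, hS]
    exact hP.steering_le_boundC hD hBD (hpsd _ (hs.cov_mem j)) (hs.C_lmi i j)
  have hT : ∀ i j, s'.T i j ≤ P.boundT s i j := fun i j => by
    rw [ht.T_value, hμ, hS]
    exact hP.gaussW2Sq_le_boundT (hs.T_lmi i j)
  have hC1 : ∀ i j, s'.C i j * s.lamT i j ≤ s.C i j * s.lamT i j := fun i j =>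
    mul_le_mul_of_nonneg_right ((hC i j).trans (hs.C_bound i j)) (hs.lam_coupling.2.2 i j)
  have hT1 : ∀ i j, s'.T i j * s.β i j ≤ s.T i j * s.β i j := fun i j =>
    mul_le_mul_of_nonneg_right ((hT i j).trans (hs.T_bound i j)) (hs.beta_coupling.2.2 i j)
  have hC2 : ∑ i, ∑ j, s'.C i j * s.lamT i j ≤ ∑ i, ∑ j, s.C i j * s.lamT i j :=
    Finset.sum_le_sum fun i _ => Finset.sum_le_sum fun j _ => hC1 i j
  have hT2 : P.κ * ∑ i, ∑ j, s'.T i j * s.β i j ≤ P.κ * ∑ i, ∑ j, s.T i j * s.β i j :=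
    mul_le_mul_of_nonneg_left
      (Finset.sum_le_sum fun i _ => Finset.sum_le_sum fun j _ => hT1 i j) hP.kappa_pos.le
  have hle : P.bilinCost s ≤ P.bilinCost s' := hmin hs'
  have hle' : P.bilinCost s' ≤ P.bilinCost s := by
    rw [bilinCost_eq, bilinCost_eq, hl, hβ]
    exact add_le_add hC2 hT2
  have hle2 := hle
  rw [bilinCost_eq, bilinCost_eq, hl, hβ] at hle2
  -- The steering and transport parts are each ordered and their totals agree, so each part agrees;
  -- since the summands are ordered as well, they are equal one by one. A positive weight can then
  -- be cancelled.
  have hC3 : ∑ i, ∑ j, s'.C i j * s.lamT i j = ∑ i, ∑ j, s.C i j * s.lamT i j := by linarith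
  have hT3 : ∑ i, ∑ j, s'.T i j * s.β i j = ∑ i, ∑ j, s.T i j * s.β i j :=
    mul_left_cancel₀ hP.kappa_pos.ne' (by linarith)
  have hC4 : ∀ i j, s'.C i j * s.lamT i j = s.C i j * s.lamT i j := fun i j =>
    (Finset.sum_eq_sum_iff_of_le fun j _ => hC1 i j).1
      ((Finset.sum_eq_sum_iff_of_le fun i _ => Finset.sum_le_sum fun j _ => hC1 i j).1 hC3 i
        (Finset.mem_univ i)) j (Finset.mem_univ j)
  have hT4 : ∀ i j, s'.T i j * s.β i j = s.T i j * s.β i j := fun i j =>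
    (Finset.sum_eq_sum_iff_of_le fun j _ => hT1 i j).1
      ((Finset.sum_eq_sum_iff_of_le fun i _ => Finset.sum_le_sum fun j _ => hT1 i j).1 hT3 i
        (Finset.mem_univ i)) j (Finset.mem_univ j)
  refine ⟨fun i j hij => ?_, fun i j hij => ?_, s', hs', fun z hz => hle'.trans (hmin hz), hl, hβ,
    hg, ht⟩
  · have h := mul_right_cancel₀ hij.ne' (hC4 i j)
    refine ⟨le_antisymm (h ▸ hC i j) (hs.C_bound i j), ?_⟩
    rw [← h, ht.C_value, hμ, hS]
  · have h := mul_right_cancel₀ hij.ne' (hT4 i j)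
    refine ⟨le_antisymm (h ▸ hT i j) (hs.T_bound i j), ?_⟩
    rw [← h, ht.T_value, hμ, hS]

end Standing

end SteeringData

/-! ### Equivalence of the two problems -/

theorem theorem2 {n m N r t q : ℕ} (hq : 0 < q) (P : SteeringData n m N r t) (hP : P.Standing)
    -- `D` is any full-rank matrix whose columns span the kernel of `B_N`
    (D : Matrix (Fin m × Fin N) (Fin (m * N - n)) ℝ) (hD : D.rank = m * N - n)
    (hBD : P.BN * D = 0)
    -- admissible terminal covariances: all positive definite, or all positive semidefinite ones
    (𝒮 : Set (Matrix (Fin n) (Fin n) ℝ))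
    (h𝒮 : 𝒮 = {S | S.PosDef} ∨ 𝒮 = {S | S.PosSemidef}) :
    -- every feasible policy has finite expected cost and produces the terminal mixture
    (∀ z ∈ P.policyFeasible q 𝒮,
      IsProbabilityMeasure (P.closedLoop z.1) ∧
      Integrable (fun x => P.cost (WithLp.ofLp x.1) x.2) (P.closedLoop z.1) ∧
      P.terminalLaw z.1 = z.2.law) ∧
    -- both problems are feasible and have the same optimal value
    (∃ v : ℝ, IsGLB (P.policyCost '' P.policyFeasible q 𝒮) v ∧
      IsGLB (P.bilinCost '' P.bilinFeasible D q 𝒮) v) ∧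
    -- the mean steering problems are solved by the closed form, and from every feasible point of
    -- the program a policy can be extracted; it is feasible and does not cost more
    (∀ μ₀ μ₁, P.SolvesMean μ₀ μ₁ (P.Ustar μ₀ μ₁)) ∧
    (∀ s ∈ P.bilinFeasible D q 𝒮,
      (∃ π : MixPolicy n m N r q, P.IsExtracted s π) ∧
      ∀ π : MixPolicy n m N r q, P.IsExtracted s π →
        (π, s.gmm) ∈ P.policyFeasible q 𝒮 ∧ P.policyCost (π, s.gmm) ≤ P.bilinCost s) ∧
    -- optimal points of the program yield optimal policies
    (∀ s ∈ P.bilinFeasible D q 𝒮, IsMinOn P.bilinCost (P.bilinFeasible D q 𝒮) s →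
      ∀ π : MixPolicy n m N r q, P.IsExtracted s π →
        IsMinOn P.policyCost (P.policyFeasible q 𝒮) (π, s.gmm) ∧
        P.policyCost (π, s.gmm) = P.bilinCost s) ∧
    -- optimal policies arise from optimal points of the program
    (∀ z ∈ P.policyFeasible q 𝒮, IsMinOn P.policyCost (P.policyFeasible q 𝒮) z →
      ∃ s ∈ P.bilinFeasible D q 𝒮, IsMinOn P.bilinCost (P.bilinFeasible D q 𝒮) s ∧
        (∀ i j, s.lamT i j = P.init.weight i * z.1.lam i j) ∧ s.gmm = z.2 ∧
        P.bilinCost s = P.policyCost z) ∧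
    -- the inequality constraints are tight at optimality: on the support of the couplings at every
    -- optimal point, and everywhere after a change of the slack variables only
    (∀ s ∈ P.bilinFeasible D q 𝒮, IsMinOn P.bilinCost (P.bilinFeasible D q 𝒮) s →
      (∀ i j, 0 < s.lamT i j → s.C i j = P.boundC D s i j ∧
        s.C i j = P.JmeanStar (P.init.mean i) (s.μN j) + P.JcovStar (P.init.cov i) (s.SN j)) ∧
      (∀ i j, 0 < s.β i j → s.T i j = P.boundT s i j ∧
        s.T i j = gaussW2Sq (s.μN i) (s.SN i) (P.des.mean j) (P.des.cov j)) ∧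
      ∃ s' ∈ P.bilinFeasible D q 𝒮, IsMinOn P.bilinCost (P.bilinFeasible D q 𝒮) s' ∧
        s'.lamT = s.lamT ∧ s'.β = s.β ∧ s'.gmm = s.gmm ∧ P.IsTight D s') := by
  have hpsd : ∀ S ∈ 𝒮, S.PosSemidef := by
    rcases h𝒮 with rfl | rfl
    · exact fun S hS => PosDef.posSemidef hS
    · exact fun S hS => hS
  have hone : (1 : Matrix (Fin n) (Fin n) ℝ) ∈ 𝒮 := by
    rcases h𝒮 with rfl | rfl
    · exact PosDef.one
    · exact PosSemidef.one
  have hext := fun s (hs : s ∈ P.bilinFeasible D q 𝒮) =>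
    hP.exists_isExtracted hq hD hBD hpsd hs
  have hfeas := fun s (hs : s ∈ P.bilinFeasible D q 𝒮) π (hπ : P.IsExtracted s π) =>
    hP.isExtracted_feasible_and_le hD hBD hpsd hs hπ
  have hconv := fun z (hz : z ∈ P.policyFeasible q 𝒮) =>
    hP.exists_bilin_le_policyCost hD hBD hpsd hz
  refine ⟨fun z hz => ⟨hP.isProbabilityMeasure_closedLoop hz.1,
    (hP.integrable_cost_and_expCost_eq hz.1).1, hP.terminalLaw_eq hz.1 hz.2.1⟩, ?_,
    fun _ _ => hP.solvesMean_Ustar _ _, fun s hs => ⟨hext s hs, fun π hπ => hfeas s hs π hπ⟩,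
    ?_, ?_, fun s hs hmin => hP.tight_of_isMinOn hD hBD hpsd hs hmin⟩
  · obtain ⟨s₀, hs₀⟩ := hP.bilinFeasible_nonempty (q := q) hq hD hBD hpsd hone
    obtain ⟨π₀, hπ₀⟩ := hext s₀ hs₀
    have hglb := isGLB_csInf
      (⟨_, _, (hfeas s₀ hs₀ π₀ hπ₀).1, rfl⟩ : (P.policyCost '' P.policyFeasible q 𝒮).Nonempty)
      ⟨0, by rintro _ ⟨z, hz, rfl⟩; exact hP.policyCost_nonneg hz.1⟩
    -- The infima agree because each feasible point of either problem is matched by one of the other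
    -- that costs no more. Neither infimum needs to be attained.
    refine ⟨_, hglb, ?_, fun b hb => hglb.2 ?_⟩
    · rintro _ ⟨s, hs, rfl⟩
      obtain ⟨π, hπ⟩ := hext s hs
      obtain ⟨h1, h2⟩ := hfeas s hs π hπ
      exact (hglb.1 ⟨_, h1, rfl⟩).trans h2
    · rintro _ ⟨z, hz, rfl⟩
      obtain ⟨s, hs, -, -, hle⟩ := hconv z hz
      exact (hb ⟨s, hs, rfl⟩).trans hle
  · intro s hs hmin π hπ
    obtain ⟨h1, h2⟩ := hfeas s hs π hπ
    have hle : ∀ z ∈ P.policyFeasible q 𝒮, P.bilinCost s ≤ P.policyCost z := by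
      intro z hz
      obtain ⟨s', hs', -, -, hle⟩ := hconv z hz
      exact (hmin hs').trans hle
    exact ⟨fun z hz => h2.trans (hle z hz), le_antisymm h2 (hle _ h1)⟩
  · intro z hz hmin
    obtain ⟨s, hs, hl, hg, hle⟩ := hconv z hz
    have hge : ∀ s' ∈ P.bilinFeasible D q 𝒮, P.policyCost z ≤ P.bilinCost s' := by
      intro s' hs'
      obtain ⟨π, hπ⟩ := hext s' hs'
      obtain ⟨h1, h2⟩ := hfeas s' hs' π hπ
      exact le_trans (hmin h1) h2
    exact ⟨s, hs, fun s' hs' => hle.trans (hge s' hs'), hl, hg, le_antisymm hle (hge s hs)⟩
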